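/- Let $\Delta>-1$, $v_0\in\mathbb Z$, and let $(X_n)_{n\ge 0}$ be a vertex-reinforced random walk on $\mathbb Z$ with weight function $W(m)=m+\Delta$ started at $v_0$: that is, a $\mathbb Z$-valued process on a probability space $(\Omega,\mathcal F,\mathbb P)$ with $X_0=v_0$ a.s. such that, with $\mathcal F_n=\sigma(X_0,\dots,X_n)$ and $Z_n(v)=1+\sum_{k=0}^n \mathbf 1_{\{X_k=v\}}$, for all $n\ge 0$ and $j\in\mathbb Z$, almost surely, on $\{X_n=i\}$, $$\mathbb P(X_{n+1}=j\mid\mathcal F_n)=\mathbf 1_{\{|i-j|=1\}}\,\frac{Z_n(j)+\Delta}{(Z_n(i-1)+\Delta)+(Z_n(i+1)+\Delta)}.$$ Let $Z_\infty(v)=\lim_n Z_n(v)\in\mathbb N\cup\{\infty\}$, let $R'=\{v\in\mathbb Z: Z_\infty(v)=\infty\}$ be the asymptotic range, and for $x\in\mathbb Z$ let $$\alpha_n^{\pm}(x)=\frac{Z_n(x\pm1)}{Z_n(x-1)+Z_n(x+1)}.$$ (a) For every $x\in\mathbb Z$, almost surely on the event $\{R'=\{x-2,x-1,x,x+1,x+2\}\}$,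 the limits $\alpha_\infty^\pm(x)=\lim_{n\to\infty}\alpha_n^\pm(x)$ exist, $\alpha_\infty^-(x)\in(0,1)$, and $$\frac{\log Z_n(x-2)}{\log Z_n(x)}\xrightarrow[n\to\infty]{}\alpha_\infty^-(x),\qquad \frac{\log Z_n(x+2)}{\log Z_n(x)}\xrightarrow[n\to\infty]{}\alpha_\infty^+(x).$$ (b) Almost surely, $|R'|\ge 5$. -/

import Mathlib

open MeasureTheory Filter Topology

noncomputable section

namespace VRRW

variable {Ω : Type*}

/-- `Z_n(v)`: the number of visits of the path `k ↦ X k ω` to `v` up to time `n`, plus one. -/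
def Z (X : ℕ → Ω → ℤ) (n : ℕ) (v : ℤ) (ω : Ω) : ℕ :=
  (∑ k ∈ Finset.range (n + 1), if X k ω = v then 1 else 0) + 1

/-- `Z_∞(v)`: the total number of visits to `v` (possibly infinite), plus one. -/
def Zinf (X : ℕ → Ω → ℤ) (v : ℤ) (ω : Ω) : ℕ∞ :=
  {k : ℕ | X k ω = v}.encard + 1

/-- The asymptotic range `R'`: the set of sites visited infinitely often. -/
def asympRange (X : ℕ → Ω → ℤ) (ω : Ω) : Set ℤ :=
  {v : ℤ | Zinf X v ω = ⊤}

/-- `α_n^-(x) = Z_n(x-1) / (Z_n(x-1) + Z_n(x+1))`. -/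
def alphaMinus (X : ℕ → Ω → ℤ) (n : ℕ) (x : ℤ) (ω : Ω) : ℝ :=
  (Z X n (x - 1) ω : ℝ) / ((Z X n (x - 1) ω : ℝ) + (Z X n (x + 1) ω : ℝ))

/-- `α_n^+(x) = Z_n(x+1) / (Z_n(x-1) + Z_n(x+1))`. -/
def alphaPlus (X : ℕ → Ω → ℤ) (n : ℕ) (x : ℤ) (ω : Ω) : ℝ :=
  (Z X n (x + 1) ω : ℝ) / ((Z X n (x - 1) ω : ℝ) + (Z X n (x + 1) ω : ℝ))

/-- The σ-algebra `F_n = σ(X_0, …, X_n)` of the past. -/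
abbrev past (X : ℕ → Ω → ℤ) (n : ℕ) : MeasurableSpace Ω :=
  ⨆ k ∈ Finset.range (n + 1), MeasurableSpace.comap (X k) ⊤

/-- The linear weight function `W(m) = m + Δ`. -/
def W (Δ : ℝ) (m : ℕ) : ℝ := (m : ℝ) + Δ

/-- The transition probability at time `n` to the site `j`: if `X_n = i`, it is
`1_{j ∼ i} W(Z_n(j)) / (W(Z_n(i-1)) + W(Z_n(i+1)))`, where `j ∼ i` means `|i - j| = 1`. -/
def stepProb (Δ : ℝ) (X : ℕ → Ω → ℤ) (n : ℕ) (j : ℤ) (ω : Ω) : ℝ :=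
  if |X n ω - j| = 1 then
    W Δ (Z X n j ω) /
      (W Δ (Z X n (X n ω - 1) ω) + W Δ (Z X n (X n ω + 1) ω))
  else 0

/-- `X` is, under `μ`, a vertex-reinforced random walk on `ℤ` started at `v₀`, with linear weight
function `W(m) = m + Δ` and propensities `1_{i ∼ j}`. -/
structure IsVRRW [MeasurableSpace Ω] (μ : Measure Ω) (Δ : ℝ) (v₀ : ℤ) (X : ℕ → Ω → ℤ) :
    Prop where
  measurable : ∀ n, Measurable (X n)
  start : ∀ᵐ ω ∂μ, X 0 ω = v₀
  step : ∀ (n : ℕ) (j : ℤ),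
    μ[Set.indicator {ω | X (n + 1) ω = j} (fun _ => (1 : ℝ)) | past X n]
      =ᵐ[μ] stepProb Δ X n j

end VRRW

end

/-! The walk at v picks v+1 or v-1 with probability proportional to the weight of the target.
Crediting each step with the inverse weight of its target therefore makes the mean credits to the
right and to the left equal, and `flowDiff` is a martingale. Every visit to a site uses a new value
of its weight, so the quadratic variation is bounded by a multiple of Σ 1/(i+Δ)²; the martingale is
bounded in L² and converges almost surely.

The asymptotics are then deterministic. For a nearest-neighbour path write u(v) for `upFlow`, the
flow from v to v+1, which differs from the flow from v to v-1 by a convergent sequence. The credits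
received by a recurrent v add up to log Z(v), so log Z(v) = u(v-1) + u(v+1) up to convergent terms,
and u(w) converges if w is within distance one of a nonrecurrent site. The recurrent sites form an
interval. With one, two or three of them, some log Z(v) would converge. With four, a,…,a+3, the
ratios Z(a)/Z(a+2) and Z(a+3)/Z(a+1) have positive limits, while Z(a) = o(Z(a+1)) and Z(a+3) =
o(Z(a+2)): the product of the ratios is contradictory. With five, centred at c, Z(c+1)/Z(c-1) has a
positive limit, both Z(c±2) are o(Z(c)), and log Z(c±2) is the flow from c±1 to c up to a convergent
term. A summation by parts shows that this flow is asymptotic to α±(c) log Z(c).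

Part (b) also needs some site to be recurrent, hence boundedness of the walk. An explicit
supermartingale (`potential`) shows that, as long as v has not been reached, v+3 is ever visited
with conditional probability at most 1-κ, with κ > 0 independent of v and of the past. Lévy's upward
theorem then makes unboundedness above a null event, and reflection gives the lower bound. -/

namespace VRRW

/-! ### Path functionals and transition probabilities -/

/-- The trajectory of the outcome `ω`. -/
def traj {Ω : Type*} (X : ℕ → Ω → ℤ) (ω : Ω) : ℕ → ℤ := fun k => X k ω

/-- One plus the number of visits of the path `x` to `v` up to time `n`. -/
def cnt (x : ℕ → ℤ) (n : ℕ) (v : ℤ) : ℕ :=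
  (∑ k ∈ Finset.range (n + 1), if x k = v then 1 else 0) + 1

lemma cnt_succ (x : ℕ → ℤ) (n : ℕ) (v : ℤ) :
    cnt x (n + 1) v = cnt x n v + if x (n + 1) = v then 1 else 0 := by
  unfold cnt
  rw [Finset.sum_range_succ _ (n + 1)]
  ring

lemma one_le_cnt (x : ℕ → ℤ) (n : ℕ) (v : ℤ) : 1 ≤ cnt x n v := Nat.le_add_left _ _

lemma cnt_mono (x : ℕ → ℤ) (v : ℤ) : Monotone fun n => cnt x n v :=
  monotone_nat_of_le_succ fun n => by rw [cnt_succ]; exact Nat.le_add_right _ _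

lemma weight_pos {Δ : ℝ} (hΔ : -1 < Δ) (x : ℕ → ℤ) (n : ℕ) (v : ℤ) :
    0 < (cnt x n v : ℝ) + Δ := by
  have : (1 : ℝ) ≤ cnt x n v := by exact_mod_cast one_le_cnt x n v
  linarith

lemma cnt_congr {x y : ℕ → ℤ} {n : ℕ} (h : ∀ k ≤ n, x k = y k) (v : ℤ) :
    cnt x n v = cnt y n v := by
  unfold cnt
  congr 1
  refine Finset.sum_congr rfl fun k hk => ?_
  rw [h k (Nat.lt_succ_iff.1 (Finset.mem_range.1 hk))]

/-- Probability that the walk with past `x 0, …, x n` steps to the right. -/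
noncomputable def probUp (Δ : ℝ) (x : ℕ → ℤ) (n : ℕ) : ℝ :=
  ((cnt x n (x n + 1) : ℝ) + Δ) /
    (((cnt x n (x n - 1) : ℝ) + Δ) + ((cnt x n (x n + 1) : ℝ) + Δ))

/-- Probability that the walk with past `x 0, …, x n` steps to the left. -/
noncomputable def probDown (Δ : ℝ) (x : ℕ → ℤ) (n : ℕ) : ℝ :=
  ((cnt x n (x n - 1) : ℝ) + Δ) /
    (((cnt x n (x n - 1) : ℝ) + Δ) + ((cnt x n (x n + 1) : ℝ) + Δ))

/-- The path `x` up to time `n`, continued by `j`. -/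
def extend (x : ℕ → ℤ) (n : ℕ) (j : ℤ) : ℕ → ℤ := Function.update x (n + 1) j

lemma extend_self (x : ℕ → ℤ) (n : ℕ) : extend x n (x (n + 1)) = x :=
  Function.update_eq_self _ _

lemma extend_succ (x : ℕ → ℤ) (n : ℕ) (j : ℤ) : extend x n j (n + 1) = j :=
  Function.update_self _ _ _

lemma extend_of_le (x : ℕ → ℤ) {n k : ℕ} (j : ℤ) (h : k ≤ n) : extend x n j k = x k :=
  Function.update_of_ne (by omega) _ _

lemma probUp_nonneg {Δ : ℝ} (hΔ : -1 < Δ) (x : ℕ → ℤ) (n : ℕ) : 0 ≤ probUp Δ x n :=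
  div_nonneg (weight_pos hΔ x n _).le
    (add_pos (weight_pos hΔ x n _) (weight_pos hΔ x n _)).le

lemma probDown_nonneg {Δ : ℝ} (hΔ : -1 < Δ) (x : ℕ → ℤ) (n : ℕ) : 0 ≤ probDown Δ x n :=
  div_nonneg (weight_pos hΔ x n _).le
    (add_pos (weight_pos hΔ x n _) (weight_pos hΔ x n _)).le

lemma probDown_add_probUp {Δ : ℝ} (hΔ : -1 < Δ) (x : ℕ → ℤ) (n : ℕ) :
    probDown Δ x n + probUp Δ x n = 1 := by
  unfold probDown probUp
  rw [← add_div]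
  exact div_self (add_pos (weight_pos hΔ x n _) (weight_pos hΔ x n _)).ne'

/-! ### Conditional expectations of path functionals -/

section Walk

section

variable {Ω : Type*} {X : ℕ → Ω → ℤ}

lemma measurable_coord_past {n k : ℕ} (h : k ≤ n) : Measurable[past X n] (X k) := by
  have h1 : MeasurableSpace.comap (X k) ⊤ ≤ past X n :=
    le_iSup₂_of_le k (Finset.mem_range.2 (Nat.lt_succ_iff.2 h)) le_rfl
  exact Measurable.mono (comap_measurable (X k)) h1 le_rfl

/-- A function of the path up to time `n` is measurable with respect to the past. -/
lemma measurable_past {β : Type*} [MeasurableSpace β] {n : ℕ} {F : (ℕ → ℤ) → β}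
    (hF : ∀ x y : ℕ → ℤ, (∀ k ≤ n, x k = y k) → F x = F y) :
    Measurable[past X n] fun ω => F (traj X ω) := by
  let r : Ω → (Fin (n + 1) → ℤ) := fun ω k => X k ω
  let e : (Fin (n + 1) → ℤ) → (ℕ → ℤ) := fun y k => if h : k < n + 1 then y ⟨k, h⟩ else 0
  have hr : Measurable[past X n] r := by
    refine @measurable_pi_lambda _ _ _ (past X n) _ r fun k => ?_
    exact measurable_coord_past (Nat.lt_succ_iff.1 k.2)
  have he : Measurable fun y => F (e y) := Measurable.of_discrete
  have : (fun ω => F (traj X ω)) = (fun y => F (e y)) ∘ r := by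
    funext ω
    refine hF _ _ fun k hk => ?_
    simp [e, r, traj, Nat.not_lt.2 hk]
  rw [this]
  exact he.comp hr

end

variable {Ω : Type*} [mΩ : MeasurableSpace Ω] {μ : Measure Ω} {Δ : ℝ} {v₀ : ℤ} {X : ℕ → Ω → ℤ}

lemma past_le (hX : ∀ n, Measurable (X n)) (n : ℕ) : past X n ≤ mΩ :=
  iSup₂_le fun k _ => (hX k).comap_le

/-- The natural filtration of the walk. -/
def pastFiltration (hX : ∀ n, Measurable (X n)) : Filtration ℕ mΩ where
  seq := past X
  mono' := fun _ _ hnm => biSup_mono fun _ hk =>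
    Finset.mem_range.2 ((Finset.mem_range.1 hk).trans_le (Nat.succ_le_succ hnm))
  le' := past_le hX

lemma measurable_traj_functional (hX : ∀ n, Measurable (X n)) {β : Type*} [MeasurableSpace β]
    {n : ℕ} {F : (ℕ → ℤ) → β} (hF : ∀ x y : ℕ → ℤ, (∀ k ≤ n, x k = y k) → F x = F y) :
    Measurable fun ω => F (traj X ω) :=
  (measurable_past hF).mono (past_le hX n) le_rfl

lemma integrable_traj_functional [IsFiniteMeasure μ] (hX : ∀ n, Measurable (X n)) {n : ℕ}
    {F : (ℕ → ℤ) → ℝ} (hF : ∀ x y : ℕ → ℤ, (∀ k ≤ n, x k = y k) → F x = F y) {C : ℝ}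
    (hC : ∀ x, |F x| ≤ C) : Integrable (fun ω => F (traj X ω)) μ :=
  Integrable.of_bound (measurable_traj_functional hX hF).aestronglyMeasurable C
    (ae_of_all _ fun _ => hC _)

variable [IsProbabilityMeasure μ]

/-- Almost surely all steps are to nearest neighbours. -/
lemma ae_abs_step (hX : IsVRRW μ Δ v₀ X) :
    ∀ᵐ ω ∂μ, ∀ n, |traj X ω (n + 1) - traj X ω n| = 1 := by
  refine ae_all_iff.2 fun n => ?_
  have key : ∀ j : ℤ, ∀ᵐ ω ∂μ, X (n + 1) ω = j → |X n ω - j| = 1 := by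
    intro j
    let s : Set Ω := {ω | |X n ω - j| ≠ 1}
    have hs : MeasurableSet[past X n] s :=
      measurable_coord_past (X := X) (le_refl n) (MeasurableSet.of_discrete (s := {i : ℤ | |i - j| ≠ 1}))
    have ht : MeasurableSet {ω | X (n + 1) ω = j} :=
      hX.measurable (n + 1) (measurableSet_singleton j)
    have hint : Integrable (Set.indicator {ω | X (n + 1) ω = j} fun _ => (1 : ℝ)) μ :=
      (integrable_const 1).indicator ht
    have h1 := setIntegral_condExp (past_le hX.measurable n) hint hs
    have h2 : ∫ ω in s, (μ[Set.indicator {ω | X (n + 1) ω = j} (fun _ => (1 : ℝ)) | past X n]) ω ∂μ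
        = 0 := by
      rw [setIntegral_congr_ae (g := fun _ => 0) (past_le hX.measurable n _ hs)]
      · simp
      · filter_upwards [hX.step n j] with ω hω hωs
        rw [hω, stepProb, if_neg hωs]
    rw [h2, setIntegral_indicator ht, setIntegral_const, smul_eq_mul, mul_one] at h1
    have h3 : μ (s ∩ {ω | X (n + 1) ω = j}) = 0 := by
      simpa [Measure.real, ENNReal.toReal_eq_zero_iff] using h1.symm
    have h4 := measure_eq_zero_iff_ae_notMem.1 h3
    filter_upwards [h4] with ω hω hj
    by_contra hne
    exact hω ⟨hne, hj⟩
  filter_upwards [ae_all_iff.2 key] with ω hω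
  have := hω _ rfl
  rw [abs_sub_comm] at this
  exact this

lemma ae_step_mem (hX : IsVRRW μ Δ v₀ X) :
    ∀ᵐ ω ∂μ, ∀ n, X (n + 1) ω = X n ω - 1 ∨ X (n + 1) ω = X n ω + 1 := by
  filter_upwards [ae_abs_step hX] with ω hω n
  have := hω n
  simp only [traj] at this
  rcases (abs_eq zero_le_one).1 this with h | h <;> omega

/-- The transition law is given for deterministic targets; it extends to the random target X n + e
by localizing on each of the countably many events X n = i, on which both indicators agree. -/
lemma condExp_indicator_step (hX : IsVRRW μ Δ v₀ X) (n : ℕ) (e : ℤ) :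
    μ[Set.indicator {ω | X (n + 1) ω = X n ω + e} (fun _ => (1 : ℝ)) | past X n]
      =ᵐ[μ] fun ω => stepProb Δ X n (X n ω + e) ω := by
  have hm := hX.measurable
  have ht : ∀ j, MeasurableSet {ω | X (n + 1) ω = j} := fun j =>
    hm (n + 1) (measurableSet_singleton j)
  have ht' : MeasurableSet {ω | X (n + 1) ω = X n ω + e} :=
    measurableSet_eq_fun (hm _) ((hm _).add_const e)
  have key : ∀ i : ℤ, ∀ᵐ ω ∂μ, X n ω = i →
      (μ[Set.indicator {ω | X (n + 1) ω = X n ω + e} (fun _ => (1 : ℝ)) | past X n]) ω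
        = stepProb Δ X n (X n ω + e) ω := by
    intro i
    have hs : MeasurableSet[past X n] {ω | X n ω = i} :=
      measurable_coord_past (X := X) (le_refl n) (measurableSet_singleton i)
    have h1 := condExp_indicator (μ := μ) (m := past X n)
      ((integrable_const (1 : ℝ)).indicator ht') hs
    have h2 := condExp_indicator (μ := μ) (m := past X n)
      ((integrable_const (1 : ℝ)).indicator (ht (i + e))) hs
    have h3 : ({ω | X n ω = i}.indicator
        (Set.indicator {ω | X (n + 1) ω = X n ω + e} fun _ => (1 : ℝ))) =
        {ω | X n ω = i}.indicator (Set.indicator {ω | X (n + 1) ω = i + e} fun _ => (1 : ℝ)) := by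
      funext ω
      by_cases h : X n ω = i <;> simp [Set.indicator, h]
    rw [h3] at h1
    filter_upwards [h1, h2, hX.step n (i + e)] with ω h1 h2 h4 hi
    rw [h1] at h2
    simp only [Set.indicator, Set.mem_ofPred_eq, hi, if_true] at h2
    rw [hi, ← h4]
    exact h2
  filter_upwards [ae_all_iff.2 key] with ω hω
  exact hω _ rfl

/-- Conditional expectation given the past at time `n` of a function of the path up to
time `n + 1`. -/
theorem condExp_traj (hX : IsVRRW μ Δ v₀ X) {n : ℕ} {F : (ℕ → ℤ) → ℝ}
    (hF : ∀ x y : ℕ → ℤ, (∀ k ≤ n + 1, x k = y k) → F x = F y) {C : ℝ} (hC : ∀ x, |F x| ≤ C) :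
    μ[fun ω => F (traj X ω) | past X n] =ᵐ[μ] fun ω =>
      probDown Δ (traj X ω) n * F (extend (traj X ω) n (traj X ω n - 1)) +
        probUp Δ (traj X ω) n * F (extend (traj X ω) n (traj X ω n + 1)) := by
  have hm := hX.measurable
  have hle := past_le hm n
  let I : ℤ → Ω → ℝ := fun e => Set.indicator {ω | X (n + 1) ω = X n ω + e} (fun _ => (1 : ℝ))
  let G : ℤ → Ω → ℝ := fun e ω => F (extend (traj X ω) n (traj X ω n + e))
  have hI : ∀ e, Integrable (I e) μ := fun e =>
    (integrable_const (1 : ℝ)).indicator (measurableSet_eq_fun (hm _) ((hm _).add_const e))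
  have hG : ∀ e, Measurable[past X n] (G e) := fun e =>
    measurable_past (F := fun x => F (extend x n (x n + e))) fun x y h => hF _ _ fun k hk => by
      rcases Nat.lt_or_ge n k with h1 | h1
      · obtain rfl : k = n + 1 := by omega
        rw [extend_succ, extend_succ, h n le_rfl]
      · rw [extend_of_le _ _ h1, extend_of_le _ _ h1, h k h1]
  have hGI : ∀ e, Integrable (G e * I e) μ := fun e =>
    (hI e).bdd_mul ((hG e).mono hle le_rfl).aestronglyMeasurable (c := C) (ae_of_all _ fun ω => hC _)
  have hpull : ∀ e, μ[G e * I e | past X n] =ᵐ[μ] G e * μ[I e | past X n] := fun e =>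
    condExp_mul_of_stronglyMeasurable_left (hG e).stronglyMeasurable (hGI e) (hI e)
  -- Exactly one of the two step indicators is 1, and extending the past by the actual step gives
  -- back the path.
  have hsplit : (fun ω => F (traj X ω)) =ᵐ[μ] G (-1) * I (-1) + G 1 * I 1 := by
    filter_upwards [ae_step_mem hX] with ω hω
    have hself : F (traj X ω) = F (extend (traj X ω) n (traj X ω (n + 1))) := by
      rw [extend_self]
    rcases hω n with h | h
    · simp only [Pi.add_apply, Pi.mul_apply, I, G, Set.indicator, Set.mem_ofPred_eq]
      rw [hself, if_pos (by omega), if_neg (by omega)]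
      simp only [traj, h, sub_eq_add_neg, mul_one, mul_zero, add_zero]
    · simp only [Pi.add_apply, Pi.mul_apply, I, G, Set.indicator, Set.mem_ofPred_eq]
      rw [hself, if_neg (by omega), if_pos (by omega)]
      simp only [traj, h, mul_one, mul_zero, zero_add]
  refine (condExp_congr_ae hsplit).trans ((condExp_add (hGI _) (hGI _) _).trans ?_)
  filter_upwards [hpull (-1), hpull 1, condExp_indicator_step hX n (-1),
    condExp_indicator_step hX n 1] with ω h1 h2 h3 h4
  rw [Pi.add_apply, h1, h2, Pi.mul_apply, Pi.mul_apply, h3, h4]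
  have e1 : stepProb Δ X n (X n ω + -1) ω = probDown Δ (traj X ω) n := by
    unfold stepProb probDown
    rw [if_pos (by norm_num)]
    rfl
  have e2 : stepProb Δ X n (X n ω + 1) ω = probUp Δ (traj X ω) n := by
    unfold stepProb probUp
    rw [if_pos (by norm_num)]
    rfl
  rw [e1, e2, mul_comm, mul_comm (G 1 ω)]
  rfl

end Walk

/-! ### Flows and their martingale identities -/

/-- The sum of the inverse weights of `v` over the steps from `u` to `v` before time `n`. -/
noncomputable def flow (Δ : ℝ) (x : ℕ → ℤ) (n : ℕ) (u v : ℤ) : ℝ :=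
  ∑ k ∈ Finset.range n, if x k = u ∧ x (k + 1) = v then 1 / ((cnt x k v : ℝ) + Δ) else 0

lemma flow_succ (Δ : ℝ) (x : ℕ → ℤ) (n : ℕ) (u v : ℤ) :
    flow Δ x (n + 1) u v = flow Δ x n u v +
      if x n = u ∧ x (n + 1) = v then 1 / ((cnt x n v : ℝ) + Δ) else 0 :=
  Finset.sum_range_succ _ _

lemma flow_congr (Δ : ℝ) {x y : ℕ → ℤ} {n : ℕ} (h : ∀ k ≤ n, x k = y k) (u v : ℤ) :
    flow Δ x n u v = flow Δ y n u v := by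
  refine Finset.sum_congr rfl fun k hk => ?_
  have hk' := Finset.mem_range.1 hk
  rw [h k hk'.le, h (k + 1) hk', cnt_congr fun i hi => h i (hi.trans hk'.le)]

lemma inv_weight_le {Δ : ℝ} (hΔ : -1 < Δ) (x : ℕ → ℤ) (n : ℕ) (v : ℤ) :
    1 / ((cnt x n v : ℝ) + Δ) ≤ 1 / (1 + Δ) := by
  have : (1 : ℝ) ≤ cnt x n v := by exact_mod_cast one_le_cnt x n v
  exact one_div_le_one_div_of_le (by linarith) (by linarith)

lemma flow_nonneg {Δ : ℝ} (hΔ : -1 < Δ) (x : ℕ → ℤ) (n : ℕ) (u v : ℤ) : 0 ≤ flow Δ x n u v :=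
  Finset.sum_nonneg fun k _ => by
    split_ifs
    · exact (one_div_pos.2 (weight_pos hΔ x k v)).le
    · exact le_rfl

lemma flow_le {Δ : ℝ} (hΔ : -1 < Δ) (x : ℕ → ℤ) (n : ℕ) (u v : ℤ) :
    flow Δ x n u v ≤ n * (1 / (1 + Δ)) := by
  have h := Finset.sum_le_card_nsmul (Finset.range n)
    (fun k => if x k = u ∧ x (k + 1) = v then 1 / ((cnt x k v : ℝ) + Δ) else 0) (1 / (1 + Δ))
    fun k _ => by
      split_ifs
      · exact inv_weight_le hΔ x k v
      · exact (one_div_pos.2 (by linarith)).le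
  simpa [flow] using h

/-- The same as `flow`, for the squares of the inverse weights. -/
noncomputable def sqFlow (Δ : ℝ) (x : ℕ → ℤ) (n : ℕ) (u v : ℤ) : ℝ :=
  ∑ k ∈ Finset.range n, if x k = u ∧ x (k + 1) = v then 1 / ((cnt x k v : ℝ) + Δ) ^ 2 else 0

lemma sqFlow_succ (Δ : ℝ) (x : ℕ → ℤ) (n : ℕ) (u v : ℤ) :
    sqFlow Δ x (n + 1) u v = sqFlow Δ x n u v +
      if x n = u ∧ x (n + 1) = v then 1 / ((cnt x n v : ℝ) + Δ) ^ 2 else 0 :=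
  Finset.sum_range_succ _ _

lemma sqFlow_congr (Δ : ℝ) {x y : ℕ → ℤ} {n : ℕ} (h : ∀ k ≤ n, x k = y k) (u v : ℤ) :
    sqFlow Δ x n u v = sqFlow Δ y n u v := by
  refine Finset.sum_congr rfl fun k hk => ?_
  have hk' := Finset.mem_range.1 hk
  rw [h k hk'.le, h (k + 1) hk', cnt_congr fun i hi => h i (hi.trans hk'.le)]

lemma sqFlow_nonneg (Δ : ℝ) (x : ℕ → ℤ) (n : ℕ) (u v : ℤ) : 0 ≤ sqFlow Δ x n u v :=
  Finset.sum_nonneg fun k _ => by split_ifs <;> positivity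

lemma min_one_mul_le {Δ : ℝ} (i : ℕ) :
    min 1 (1 + Δ) * ((i : ℝ) + 1) ≤ (i : ℝ) + 1 + Δ := by
  have hi : (0 : ℝ) ≤ i := Nat.cast_nonneg i
  rcases le_total 0 Δ with h | h
  · rw [min_eq_left (by linarith)]; linarith
  · rw [min_eq_right (by linarith)]; nlinarith

lemma summable_inv_sq_weight {Δ : ℝ} (hΔ : -1 < Δ) :
    Summable fun i : ℕ => 1 / ((i : ℝ) + Δ) ^ 2 := by
  have hc : 0 < min 1 (1 + Δ) := lt_min one_pos (by linarith)
  rw [← summable_nat_add_iff 1]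
  have hs : Summable fun i : ℕ => (1 / (min 1 (1 + Δ)) ^ 2) * (1 / ((i + 1 : ℕ) : ℝ) ^ 2) :=
    ((summable_nat_add_iff 1).2 (Real.summable_one_div_nat_pow.2 one_lt_two)).mul_left _
  refine Summable.of_nonneg_of_le (fun i => by positivity) (fun i => ?_) hs
  rw [one_div_mul_one_div, ← mul_pow]
  push_cast
  have hpos : 0 < min 1 (1 + Δ) * ((i : ℝ) + 1) := by positivity
  exact one_div_le_one_div_of_le (by positivity)
    (pow_le_pow_left₀ hpos.le (min_one_mul_le i) 2)

/-- Each counted step raises `cnt` at v, so the summands are distinct terms of one convergent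
series. This bounds the quadratic variation uniformly in the path. -/
lemma sqFlow_le {Δ : ℝ} (hΔ : -1 < Δ) (x : ℕ → ℤ) (n : ℕ) (u v : ℤ) :
    sqFlow Δ x n u v ≤ ∑' i : ℕ, 1 / ((i : ℝ) + Δ) ^ 2 := by
  have h : sqFlow Δ x n u v ≤ ∑ i ∈ Finset.range (cnt x n v), 1 / ((i : ℝ) + Δ) ^ 2 := by
    induction n with
    | zero => exact Finset.sum_nonneg fun i _ => by positivity
    | succ n ih =>
      rw [sqFlow_succ, cnt_succ]
      by_cases h1 : x (n + 1) = v
      · rw [if_pos h1, Finset.sum_range_succ]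
        refine add_le_add ih ?_
        split_ifs
        · exact le_rfl
        · positivity
      · rw [if_neg h1, if_neg fun h => h1 h.2]
        simpa using ih
  exact h.trans ((summable_inv_sq_weight hΔ).sum_le_tsum _ fun i _ => by positivity)

/-- The difference between the flows out of `v` to the right and to the left. -/
noncomputable def flowDiff (Δ : ℝ) (x : ℕ → ℤ) (n : ℕ) (v : ℤ) : ℝ :=
  flow Δ x n v (v + 1) - flow Δ x n v (v - 1)

lemma flowDiff_congr (Δ : ℝ) {x y : ℕ → ℤ} {n : ℕ} (h : ∀ k ≤ n, x k = y k) (v : ℤ) :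
    flowDiff Δ x n v = flowDiff Δ y n v := by
  unfold flowDiff
  rw [flow_congr Δ h, flow_congr Δ h]

lemma abs_flowDiff_le {Δ : ℝ} (hΔ : -1 < Δ) (x : ℕ → ℤ) (n : ℕ) (v : ℤ) :
    |flowDiff Δ x n v| ≤ n * (1 / (1 + Δ)) :=
  abs_sub_le_of_nonneg_of_le (flow_nonneg hΔ _ _ _ _) (flow_le hΔ _ _ _ _)
    (flow_nonneg hΔ _ _ _ _) (flow_le hΔ _ _ _ _)

lemma flowDiff_extend_of_ne (Δ : ℝ) {x : ℕ → ℤ} {n : ℕ} {v : ℤ} (h : x n ≠ v) (j : ℤ) :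
    flowDiff Δ (extend x n j) (n + 1) v = flowDiff Δ x n v := by
  have h0 : ∀ k ≤ n, extend x n j k = x k := fun k hk => extend_of_le x j hk
  unfold flowDiff
  rw [flow_succ, flow_succ, flow_congr Δ h0, flow_congr Δ h0, h0 n le_rfl, if_neg (fun h' => h h'.1),
    if_neg (fun h' => h h'.1)]
  ring

lemma flowDiff_extend_up (Δ : ℝ) (x : ℕ → ℤ) (n : ℕ) :
    flowDiff Δ (extend x n (x n + 1)) (n + 1) (x n) =
      flowDiff Δ x n (x n) + 1 / ((cnt x n (x n + 1) : ℝ) + Δ) := by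
  have h0 : ∀ k ≤ n, extend x n (x n + 1) k = x k := fun k hk => extend_of_le x _ hk
  unfold flowDiff
  rw [flow_succ, flow_succ, flow_congr Δ h0, flow_congr Δ h0, h0 n le_rfl, extend_succ,
    if_pos ⟨rfl, rfl⟩, if_neg (fun h' => by have := h'.2; omega), cnt_congr h0]
  ring

lemma flowDiff_extend_down (Δ : ℝ) (x : ℕ → ℤ) (n : ℕ) :
    flowDiff Δ (extend x n (x n - 1)) (n + 1) (x n) =
      flowDiff Δ x n (x n) - 1 / ((cnt x n (x n - 1) : ℝ) + Δ) := by
  have h0 : ∀ k ≤ n, extend x n (x n - 1) k = x k := fun k hk => extend_of_le x _ hk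
  unfold flowDiff
  rw [flow_succ, flow_succ, flow_congr Δ h0, flow_congr Δ h0, h0 n le_rfl, extend_succ,
    if_neg (fun h' => by have := h'.2; omega), if_pos ⟨rfl, rfl⟩, cnt_congr h0]
  ring

/-- The square of `flowDiff`, compensated by its quadratic variation. -/
noncomputable def flowSq (Δ : ℝ) (x : ℕ → ℤ) (n : ℕ) (v : ℤ) : ℝ :=
  flowDiff Δ x n v ^ 2 - (sqFlow Δ x n v (v + 1) + sqFlow Δ x n v (v - 1))

lemma flowSq_congr (Δ : ℝ) {x y : ℕ → ℤ} {n : ℕ} (h : ∀ k ≤ n, x k = y k) (v : ℤ) :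
    flowSq Δ x n v = flowSq Δ y n v := by
  unfold flowSq
  rw [flowDiff_congr Δ h, sqFlow_congr Δ h, sqFlow_congr Δ h]

lemma abs_flowSq_le {Δ : ℝ} (hΔ : -1 < Δ) (x : ℕ → ℤ) (n : ℕ) (v : ℤ) :
    |flowSq Δ x n v| ≤ (n * (1 / (1 + Δ))) ^ 2 + 2 * ∑' i : ℕ, 1 / ((i : ℝ) + Δ) ^ 2 := by
  have h1 := sqFlow_le hΔ x n v (v + 1)
  have h2 := sqFlow_le hΔ x n v (v - 1)
  have h3 := sqFlow_nonneg Δ x n v (v + 1)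
  have h4 := sqFlow_nonneg Δ x n v (v - 1)
  have h5 := pow_le_pow_left₀ (abs_nonneg _) (abs_flowDiff_le hΔ x n v) 2
  rw [sq_abs] at h5
  have h6 := sq_nonneg (flowDiff Δ x n v)
  unfold flowSq
  rw [abs_le]
  constructor <;> nlinarith

lemma flowSq_extend_of_ne (Δ : ℝ) {x : ℕ → ℤ} {n : ℕ} {v : ℤ} (h : x n ≠ v) (j : ℤ) :
    flowSq Δ (extend x n j) (n + 1) v = flowSq Δ x n v := by
  have h0 : ∀ k ≤ n, extend x n j k = x k := fun k hk => extend_of_le x j hk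
  unfold flowSq
  rw [flowDiff_extend_of_ne Δ h, sqFlow_succ, sqFlow_succ, sqFlow_congr Δ h0, sqFlow_congr Δ h0,
    h0 n le_rfl, if_neg (fun h' => h h'.1), if_neg (fun h' => h h'.1)]
  ring

lemma flowSq_extend_up (Δ : ℝ) (x : ℕ → ℤ) (n : ℕ) :
    flowSq Δ (extend x n (x n + 1)) (n + 1) (x n) =
      flowSq Δ x n (x n) + 2 * flowDiff Δ x n (x n) * (1 / ((cnt x n (x n + 1) : ℝ) + Δ)) := by
  have h0 : ∀ k ≤ n, extend x n (x n + 1) k = x k := fun k hk => extend_of_le x _ hk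
  unfold flowSq
  rw [flowDiff_extend_up, sqFlow_succ, sqFlow_succ, sqFlow_congr Δ h0, sqFlow_congr Δ h0,
    h0 n le_rfl, extend_succ, if_pos ⟨rfl, rfl⟩, if_neg (fun h' => by have := h'.2; omega),
    cnt_congr h0, ← one_div_pow]
  ring

lemma flowSq_extend_down (Δ : ℝ) (x : ℕ → ℤ) (n : ℕ) :
    flowSq Δ (extend x n (x n - 1)) (n + 1) (x n) =
      flowSq Δ x n (x n) - 2 * flowDiff Δ x n (x n) * (1 / ((cnt x n (x n - 1) : ℝ) + Δ)) := by
  have h0 : ∀ k ≤ n, extend x n (x n - 1) k = x k := fun k hk => extend_of_le x _ hk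
  unfold flowSq
  rw [flowDiff_extend_down, sqFlow_succ, sqFlow_succ, sqFlow_congr Δ h0, sqFlow_congr Δ h0,
    h0 n le_rfl, extend_succ, if_neg (fun h' => by have := h'.2; omega), if_pos ⟨rfl, rfl⟩,
    cnt_congr h0, ← one_div_pow]
  ring

/-- Both sides are the inverse of the total weight of the two neighbours: this cancellation is the
source of both martingales. -/
lemma prob_mul_inv_weight {Δ : ℝ} (hΔ : -1 < Δ) (x : ℕ → ℤ) (n : ℕ) :
    probDown Δ x n * (1 / ((cnt x n (x n - 1) : ℝ) + Δ)) =
      probUp Δ x n * (1 / ((cnt x n (x n + 1) : ℝ) + Δ)) := by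
  have h1 := weight_pos hΔ x n (x n - 1)
  have h2 := weight_pos hΔ x n (x n + 1)
  unfold probDown probUp
  field_simp

lemma mean_flowDiff {Δ : ℝ} (hΔ : -1 < Δ) (x : ℕ → ℤ) (n : ℕ) (v : ℤ) :
    probDown Δ x n * flowDiff Δ (extend x n (x n - 1)) (n + 1) v +
      probUp Δ x n * flowDiff Δ (extend x n (x n + 1)) (n + 1) v = flowDiff Δ x n v := by
  have h1 := probDown_add_probUp hΔ x n
  by_cases h : x n = v
  · subst h
    rw [flowDiff_extend_up, flowDiff_extend_down]
    linear_combination flowDiff Δ x n (x n) * h1 - prob_mul_inv_weight hΔ x n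
  · rw [flowDiff_extend_of_ne Δ h, flowDiff_extend_of_ne Δ h]
    linear_combination flowDiff Δ x n v * h1

lemma mean_flowSq {Δ : ℝ} (hΔ : -1 < Δ) (x : ℕ → ℤ) (n : ℕ) (v : ℤ) :
    probDown Δ x n * flowSq Δ (extend x n (x n - 1)) (n + 1) v +
      probUp Δ x n * flowSq Δ (extend x n (x n + 1)) (n + 1) v = flowSq Δ x n v := by
  have h1 := probDown_add_probUp hΔ x n
  by_cases h : x n = v
  · subst h
    rw [flowSq_extend_up, flowSq_extend_down]
    linear_combination flowSq Δ x n (x n) * h1 -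
      2 * flowDiff Δ x n (x n) * prob_mul_inv_weight hΔ x n
  · rw [flowSq_extend_of_ne Δ h, flowSq_extend_of_ne Δ h]
    linear_combination flowSq Δ x n v * h1

/-! ### Almost sure convergence of the flow differences -/

section Walk

variable {Ω : Type*} [mΩ : MeasurableSpace Ω] {μ : Measure Ω} [IsProbabilityMeasure μ] {Δ : ℝ}
  {v₀ : ℤ} {X : ℕ → Ω → ℤ}

lemma martingale_traj (hX : IsVRRW μ Δ v₀ X) {F : ℕ → (ℕ → ℤ) → ℝ}
    (hF : ∀ n, ∀ x y : ℕ → ℤ, (∀ k ≤ n, x k = y k) → F n x = F n y) {C : ℕ → ℝ}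
    (hC : ∀ n x, |F n x| ≤ C n)
    (hmean : ∀ n x, probDown Δ x n * F (n + 1) (extend x n (x n - 1)) +
      probUp Δ x n * F (n + 1) (extend x n (x n + 1)) = F n x) :
    Martingale (fun n ω => F n (traj X ω)) (pastFiltration hX.measurable) μ := by
  refine martingale_nat (fun n => (measurable_past (hF n)).stronglyMeasurable)
    (fun n => integrable_traj_functional hX.measurable (hF n) (hC n)) fun n => ?_
  refine EventuallyEq.symm ((condExp_traj hX (hF (n + 1)) (hC (n + 1))).trans ?_)
  exact ae_of_all _ fun ω => hmean n _

lemma ae_exists_tendsto_flowDiff (hΔ : -1 < Δ) (hX : IsVRRW μ Δ v₀ X) (v : ℤ) :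
    ∀ᵐ ω ∂μ, ∃ c, Tendsto (fun n => flowDiff Δ (traj X ω) n v) atTop (𝓝 c) := by
  have hM : Martingale (fun n ω => flowDiff Δ (traj X ω) n v) (pastFiltration hX.measurable) μ :=
    martingale_traj hX (F := fun n x => flowDiff Δ x n v) (fun n x y h => flowDiff_congr Δ h v)
      (fun n x => abs_flowDiff_le hΔ x n v) fun n x => mean_flowDiff hΔ x n v
  have hQ : Martingale (fun n ω => flowSq Δ (traj X ω) n v) (pastFiltration hX.measurable) μ :=
    martingale_traj hX (F := fun n x => flowSq Δ x n v) (fun n x y h => flowSq_congr Δ h v)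
      (fun n x => abs_flowSq_le hΔ x n v) fun n x => mean_flowSq hΔ x n v
  set T : ℝ := ∑' i : ℕ, 1 / ((i : ℝ) + Δ) ^ 2
  have hQ0 : ∀ n, ∫ ω, flowSq Δ (traj X ω) n v ∂μ = 0 := fun n => by
    have h := hQ.setIntegral_eq (Nat.zero_le n) MeasurableSet.univ
    simp only [Measure.restrict_univ] at h
    rw [← h]
    simp [flowSq, flowDiff, flow, sqFlow]
  -- The L¹ bound comes from |d| ≤ 1 + d²: the square d² is `flowSq`, of mean zero, plus two sums
  -- each at most T.
  refine hM.submartingale.exists_ae_tendsto_of_bdd (R := (1 + 2 * T).toNNReal) fun n => ?_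
  have hint : Integrable (fun ω => flowDiff Δ (traj X ω) n v) μ := hM.integrable n
  rw [eLpNorm_one_eq_lintegral_enorm, ← ofReal_integral_norm_eq_lintegral_enorm hint]
  refine ENNReal.ofReal_le_ofReal ?_
  calc ∫ ω, ‖flowDiff Δ (traj X ω) n v‖ ∂μ
      ≤ ∫ ω, (1 + 2 * T + flowSq Δ (traj X ω) n v) ∂μ := by
        refine integral_mono hint.norm ((integrable_const _).add (hQ.integrable n)) fun ω => ?_
        have h1 := sqFlow_le hΔ (traj X ω) n v (v + 1)
        have h2 := sqFlow_le hΔ (traj X ω) n v (v - 1)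
        have h3 := sq_nonneg (|flowDiff Δ (traj X ω) n v| - 1)
        have h4 := abs_nonneg (flowDiff Δ (traj X ω) n v)
        have h5 := sq_abs (flowDiff Δ (traj X ω) n v)
        simp only [Real.norm_eq_abs, flowSq]
        nlinarith
    _ = 1 + 2 * T := by
        rw [integral_add (integrable_const _) (hQ.integrable n), hQ0]
        simp

end Walk

/-! ### Recurrent sites, logarithms and step counts -/

/-- The real sequence `f` converges. -/
def Conv (f : ℕ → ℝ) : Prop := ∃ c, Tendsto f atTop (𝓝 c)

lemma Conv.add {f g : ℕ → ℝ} (hf : Conv f) (hg : Conv g) : Conv fun n => f n + g n :=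
  ⟨_, hf.choose_spec.add hg.choose_spec⟩

lemma Conv.sub {f g : ℕ → ℝ} (hf : Conv f) (hg : Conv g) : Conv fun n => f n - g n :=
  ⟨_, hf.choose_spec.sub hg.choose_spec⟩

lemma conv_const (c : ℝ) : Conv fun _ => c := ⟨c, tendsto_const_nhds⟩

lemma Conv.congr {f g : ℕ → ℝ} (hf : Conv f) (h : ∀ n, f n = g n) : Conv g :=
  ⟨_, hf.choose_spec.congr h⟩

lemma conv_of_eventually_const {f : ℕ → ℝ} (K : ℕ) (h : ∀ n, K ≤ n → f (n + 1) = f n) :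
    Conv f := by
  refine ⟨f K, tendsto_const_nhds.congr' ?_⟩
  filter_upwards [eventually_ge_atTop K] with n hn
  induction n, hn using Nat.le_induction with
  | base => rfl
  | succ n hn ih => rw [h n hn, ih]

/-- The sites visited infinitely often by the path `x`. -/
def recurrentSites (x : ℕ → ℤ) : Set ℤ := {v | {k | x k = v}.Infinite}

lemma asympRange_eq {Ω : Type*} (X : ℕ → Ω → ℤ) (ω : Ω) :
    asympRange X ω = recurrentSites (traj X ω) := by
  ext v
  have h : Zinf X v ω = {k | traj X ω k = v}.encard + 1 := rfl
  rw [asympRange, recurrentSites, Set.mem_ofPred_eq, Set.mem_ofPred_eq, h,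
    ← Set.encard_eq_top_iff]
  simp

lemma exists_ne_of_notMem {x : ℕ → ℤ} {v : ℤ} (h : v ∉ recurrentSites x) :
    ∃ K, ∀ n, K ≤ n → x n ≠ v := by
  have hf : {k | x k = v}.Finite := Set.not_infinite.1 h
  obtain ⟨K, hK⟩ := hf.bddAbove
  refine ⟨K + 1, fun n hn hv => ?_⟩
  have := hK (show n ∈ {k | x k = v} from hv)
  omega

lemma exists_eq_of_mem {x : ℕ → ℤ} {v : ℤ} (h : v ∈ recurrentSites x) (N : ℕ) :
    ∃ n, N < n ∧ x n = v := by
  obtain ⟨n, hn, hN⟩ := Set.Infinite.exists_gt h N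
  exact ⟨n, hN, hn⟩

lemma tendsto_cnt {x : ℕ → ℤ} {v : ℤ} (h : v ∈ recurrentSites x) :
    Tendsto (fun n => cnt x n v) atTop atTop := by
  refine tendsto_atTop_atTop_of_monotone (cnt_mono x v) fun b => ?_
  induction b with
  | zero => exact ⟨0, Nat.zero_le _⟩
  | succ b ih =>
    obtain ⟨n, hn⟩ := ih
    obtain ⟨m, hm, hv⟩ := exists_eq_of_mem h n
    obtain ⟨m, rfl⟩ : ∃ m', m = m' + 1 := ⟨m - 1, by omega⟩
    refine ⟨m + 1, ?_⟩
    rw [cnt_succ, if_pos hv]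
    have := cnt_mono x v (show n ≤ m by omega)
    simp only at this
    omega

lemma tendsto_cnt_real {x : ℕ → ℤ} {v : ℤ} (h : v ∈ recurrentSites x) :
    Tendsto (fun n => (cnt x n v : ℝ)) atTop atTop :=
  tendsto_natCast_atTop_atTop.comp (tendsto_cnt h)

lemma tendsto_log_cnt {x : ℕ → ℤ} {v : ℤ} (h : v ∈ recurrentSites x) :
    Tendsto (fun n => Real.log (cnt x n v)) atTop atTop :=
  Real.tendsto_log_atTop.comp (tendsto_cnt_real h)

/-- `∑_{i < m} 1 / (i + Δ)`. -/
noncomputable def recipSum (Δ : ℝ) (m : ℕ) : ℝ := ∑ i ∈ Finset.range m, 1 / ((i : ℝ) + Δ)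

lemma conv_recipSum_sub_log {Δ : ℝ} (hΔ : -1 < Δ) :
    Conv fun m => recipSum Δ m - Real.log m := by
  have hc : 0 < min 1 (1 + Δ) := lt_min one_pos (by linarith)
  -- The term i = 0 may be negative, or 1/0 = 0 when Δ = 0. It is harmless: counts start at 1, and
  -- only i ≥ 1 must be estimated.
  have hs : Summable fun i : ℕ => 1 / ((i : ℝ) + Δ) - 1 / ((i : ℝ) + 1) := by
    rw [← summable_nat_add_iff 1]
    have hs' : Summable fun i : ℕ =>
        (|1 - Δ| / (min 1 (1 + Δ))) * (1 / ((i + 1 : ℕ) : ℝ) ^ 2) :=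
      ((summable_nat_add_iff 1).2 (Real.summable_one_div_nat_pow.2 one_lt_two)).mul_left _
    refine Summable.of_norm_bounded hs' fun i => ?_
    have h1 := min_one_mul_le (Δ := Δ) i
    have hi : (0 : ℝ) ≤ i := Nat.cast_nonneg i
    have h2 : 0 < min 1 (1 + Δ) * ((i : ℝ) + 1) := by positivity
    have h3 : 0 < (i : ℝ) + 1 + Δ := h2.trans_le h1
    push_cast
    have e : 1 / ((i : ℝ) + 1 + Δ) - 1 / ((i : ℝ) + 1 + 1) =
        (1 - Δ) / (((i : ℝ) + 1 + Δ) * ((i : ℝ) + 1 + 1)) := by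
      field_simp
      ring
    rw [e, Real.norm_eq_abs, abs_div, abs_of_pos (mul_pos h3 (by linarith)),
      div_mul_div_comm, mul_one]
    refine div_le_div_of_nonneg_left (abs_nonneg _) (by positivity) ?_
    rw [pow_two, ← mul_assoc]
    exact mul_le_mul h1 (by linarith) (by linarith) h3.le
  have h1 : Conv fun m => ∑ i ∈ Finset.range m, (1 / ((i : ℝ) + Δ) - 1 / ((i : ℝ) + 1)) :=
    ⟨_, hs.hasSum.tendsto_sum_nat⟩
  have h2 : Conv fun n => (harmonic n : ℝ) - Real.log n := ⟨_, Real.tendsto_harmonic_sub_log⟩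
  refine (h1.add h2).congr fun m => ?_
  rw [Finset.sum_sub_distrib, recipSum]
  simp only [harmonic, Rat.cast_sum]
  push_cast
  simp only [one_div]
  ring

/-- The number of steps from `u` to `v` before time `n`. -/
def steps (x : ℕ → ℤ) (n : ℕ) (u v : ℤ) : ℕ :=
  ∑ k ∈ Finset.range n, if x k = u ∧ x (k + 1) = v then 1 else 0

lemma steps_succ (x : ℕ → ℤ) (n : ℕ) (u v : ℤ) :
    steps x (n + 1) u v = steps x n u v + if x n = u ∧ x (n + 1) = v then 1 else 0 :=
  Finset.sum_range_succ _ _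

/-- Successive positions of the path are nearest neighbours. -/
def IsNNPath (x : ℕ → ℤ) : Prop := ∀ n, x (n + 1) = x n - 1 ∨ x (n + 1) = x n + 1

/-! ### Logarithms of visit counts as sums of flows -/

section Path

variable {Δ : ℝ} {x : ℕ → ℤ}

lemma recipSum_cnt (hx : IsNNPath x) (n : ℕ) (v : ℤ) :
    recipSum Δ (cnt x n v) =
      recipSum Δ (cnt x 0 v) + flow Δ x n (v - 1) v + flow Δ x n (v + 1) v := by
  induction n with
  | zero => simp [flow]
  | succ n ih =>
    rw [cnt_succ, flow_succ, flow_succ]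
    by_cases h : x (n + 1) = v
    · rw [if_pos h, recipSum, Finset.sum_range_succ, ← recipSum, ih]
      rcases hx n with h' | h'
      · rw [if_neg (by omega), if_pos (by omega)]; ring
      · rw [if_pos (by omega), if_neg (by omega)]; ring
    · rw [if_neg h, if_neg (by omega), if_neg (by omega), add_zero, ih]; ring

lemma cnt_eq_steps_in (hx : IsNNPath x) (n : ℕ) (v : ℤ) :
    cnt x n v = cnt x 0 v + steps x n (v - 1) v + steps x n (v + 1) v := by
  induction n with
  | zero => simp [steps]
  | succ n ih =>
    rw [cnt_succ, steps_succ, steps_succ, ih]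
    by_cases h : x (n + 1) = v
    · rcases hx n with h' | h'
      · rw [if_pos h, if_neg (by omega), if_pos (by omega)]; ring
      · rw [if_pos h, if_pos (by omega), if_neg (by omega)]; ring
    · rw [if_neg h, if_neg (by omega), if_neg (by omega)]; ring

lemma cnt_eq_steps_out (hx : IsNNPath x) (n : ℕ) (v : ℤ) :
    cnt x n v = 1 + (if x n = v then 1 else 0) + steps x n v (v - 1) + steps x n v (v + 1) := by
  induction n with
  | zero =>
    simp only [cnt, steps, zero_add, Finset.sum_range_one, Finset.range_zero, Finset.sum_empty]
    ring
  | succ n ih =>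
    rw [cnt_succ, steps_succ, steps_succ, ih]
    by_cases h : x n = v
    · rcases hx n with h' | h'
      · rw [if_pos h, if_pos (by omega : x n = v ∧ x (n + 1) = v - 1), if_neg (by omega),
          if_neg (by omega)]; ring
      · rw [if_pos h, if_neg (by omega), if_neg (by omega),
          if_pos (by omega : x n = v ∧ x (n + 1) = v + 1)]; ring
    · rw [if_neg h, if_neg (by omega : ¬(x n = v ∧ x (n + 1) = v - 1)),
        if_neg (by omega : ¬(x n = v ∧ x (n + 1) = v + 1))]; ring

lemma steps_le_cnt (n : ℕ) (u v : ℤ) : steps x n u v ≤ cnt x n v := by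
  induction n with
  | zero => simp [steps]
  | succ n ih =>
    rw [cnt_succ, steps_succ]
    refine add_le_add ih ?_
    split_ifs with h1 h2
    · exact le_rfl
    · exact absurd h1.2 h2
    · exact Nat.zero_le _
    · exact le_rfl

lemma conv_flow_of_notMem_left {u : ℤ} (hu : u ∉ recurrentSites x) (v : ℤ) :
    Conv fun n => flow Δ x n u v := by
  obtain ⟨K, hK⟩ := exists_ne_of_notMem hu
  refine conv_of_eventually_const K fun n hn => ?_
  rw [flow_succ, if_neg fun h => hK n hn h.1, add_zero]

lemma conv_flow_of_notMem_right {v : ℤ} (hv : v ∉ recurrentSites x) (u : ℤ) :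
    Conv fun n => flow Δ x n u v := by
  obtain ⟨K, hK⟩ := exists_ne_of_notMem hv
  refine conv_of_eventually_const K fun n hn => ?_
  rw [flow_succ, if_neg fun h => hK (n + 1) (by omega) h.2, add_zero]

lemma conv_log_cnt_sub_flow (hΔ : -1 < Δ) (hx : IsNNPath x) {v : ℤ} (hv : v ∈ recurrentSites x) :
    Conv fun n => Real.log (cnt x n v) - (flow Δ x n (v - 1) v + flow Δ x n (v + 1) v) := by
  obtain ⟨c, hc⟩ := conv_recipSum_sub_log hΔ
  have h1 : Conv fun n => recipSum Δ (cnt x n v) - Real.log (cnt x n v) :=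
    ⟨c, hc.comp (tendsto_cnt hv)⟩
  refine ((conv_const (recipSum Δ (cnt x 0 v))).sub h1).congr fun n => ?_
  rw [recipSum_cnt hx n v]
  ring

/-- The flow from `v` to `v + 1`. -/
noncomputable def upFlow (Δ : ℝ) (x : ℕ → ℤ) (n : ℕ) (v : ℤ) : ℝ := flow Δ x n v (v + 1)

variable (hΔ : -1 < Δ) (hx : IsNNPath x) (hM : ∀ v, Conv fun n => flowDiff Δ x n v)
include hM

lemma conv_upFlow_sub_downFlow (v : ℤ) :
    Conv fun n => upFlow Δ x n (v + 1) - flow Δ x n (v + 1) v :=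
  (hM (v + 1)).congr fun n => by rw [flowDiff, upFlow, add_sub_cancel_right]

/-- Steps into or out of v are finitely many, which settles w = v-1 and w = v. For w = v+1 the flow
back into v is eventually constant, and the convergent flow difference at v+1 transfers this to the
flow to the right. -/
lemma conv_upFlow_of_notMem {v w : ℤ} (hv : v ∉ recurrentSites x)
    (hw : w = v - 1 ∨ w = v ∨ w = v + 1) : Conv fun n => upFlow Δ x n w := by
  rcases hw with rfl | rfl | rfl
  · unfold upFlow
    rw [sub_add_cancel]
    exact conv_flow_of_notMem_right hv _
  · exact conv_flow_of_notMem_left hv _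
  · exact ((conv_upFlow_sub_downFlow hM v).add (conv_flow_of_notMem_right hv _)).congr
      fun n => by ring

include hΔ hx

lemma conv_log_cnt_sub_upFlow {v : ℤ} (hv : v ∈ recurrentSites x) :
    Conv fun n => Real.log (cnt x n v) - (upFlow Δ x n (v - 1) + upFlow Δ x n (v + 1)) := by
  refine ((conv_log_cnt_sub_flow hΔ hx hv).sub (conv_upFlow_sub_downFlow hM v)).congr fun n => ?_
  simp only [upFlow, sub_add_cancel]
  ring

lemma not_conv_upFlow_both {v : ℤ} (hv : v ∈ recurrentSites x)
    (h1 : Conv fun n => upFlow Δ x n (v - 1)) (h2 : Conv fun n => upFlow Δ x n (v + 1)) :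
    False := by
  have h : Conv fun n => Real.log (cnt x n v) :=
    ((conv_log_cnt_sub_upFlow hΔ hx hM hv).add (h1.add h2)).congr fun n => by ring
  exact not_tendsto_nhds_of_tendsto_atTop (tendsto_log_cnt hv) _ h.choose_spec

end Path

/-! ### Excluding four or fewer recurrent sites -/

section Path

variable {Δ : ℝ} {x : ℕ → ℤ}

lemma exists_eq_between (hx : IsNNPath x) {c : ℤ} {n m : ℕ} (hnm : n ≤ m) (hn : x n ≤ c)
    (hm : c ≤ x m) : ∃ k, n ≤ k ∧ k ≤ m ∧ x k = c := by
  induction m, hnm using Nat.le_induction with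
  | base => exact ⟨n, le_rfl, le_rfl, le_antisymm hn hm⟩
  | succ m hnm ih =>
    by_cases h : c ≤ x m
    · obtain ⟨k, h1, h2, h3⟩ := ih h
      exact ⟨k, h1, h2.trans (Nat.le_succ m), h3⟩
    · refine ⟨m + 1, by omega, le_rfl, ?_⟩
      rcases hx m with h' | h' <;> omega

lemma mem_recurrentSites_of_between (hx : IsNNPath x) {a b c : ℤ} (ha : a ∈ recurrentSites x)
    (hb : b ∈ recurrentSites x) (hac : a ≤ c) (hcb : c ≤ b) : c ∈ recurrentSites x := by
  refine Set.infinite_of_not_bddAbove fun ⟨N, hN⟩ => ?_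
  obtain ⟨n, hn, hna⟩ := exists_eq_of_mem ha N
  obtain ⟨m, hm, hmb⟩ := exists_eq_of_mem hb n
  obtain ⟨k, hk, -, hkc⟩ := exists_eq_between hx hm.le (hna.trans_le hac) (hcb.trans_eq hmb.symm)
  have := hN (show k ∈ {k | x k = c} from hkc)
  omega

lemma cnt_eq_steps_out' (hx : IsNNPath x) {e : ℤ} (he : e = 1 ∨ e = -1) (n : ℕ) (v : ℤ) :
    cnt x n v = 1 + (if x n = v then 1 else 0) + steps x n v (v - e) + steps x n v (v + e) := by
  rw [cnt_eq_steps_out hx n v]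
  rcases he with rfl | rfl
  · rfl
  · rw [sub_neg_eq_add, ← sub_eq_add_neg]; ring

lemma cnt_eq_steps_in' (hx : IsNNPath x) {e : ℤ} (he : e = 1 ∨ e = -1) (n : ℕ) (v : ℤ) :
    cnt x n v = cnt x 0 v + steps x n (v - e) v + steps x n (v + e) v := by
  rw [cnt_eq_steps_in hx n v]
  rcases he with rfl | rfl
  · rfl
  · rw [sub_neg_eq_add, ← sub_eq_add_neg]; ring

lemma cnt_isBigO_one {v : ℤ} (hv : v ∉ recurrentSites x) :
    (fun n => (cnt x n v : ℝ)) =O[atTop] fun _ => (1 : ℝ) := by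
  obtain ⟨K, hK⟩ := exists_ne_of_notMem hv
  have h : Conv fun n => (cnt x n v : ℝ) := conv_of_eventually_const K fun n hn => by
    rw [cnt_succ, if_neg (hK (n + 1) (by omega)), add_zero]
  exact h.choose_spec.isBigO_one ℝ

lemma one_isLittleO_cnt {v : ℤ} (hv : v ∈ recurrentSites x) :
    (fun _ => (1 : ℝ)) =o[atTop] fun n => (cnt x n v : ℝ) :=
  (Asymptotics.isLittleO_const_left.2 (Or.inr (tendsto_norm_atTop_atTop.comp (tendsto_cnt_real hv))))

/-- Weights only grow, so each step between times K and n contributes at least the inverse of the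
final weight to the flow. -/
lemma steps_sub_le (hΔ : -1 < Δ) (u v : ℤ) {K n : ℕ} (h : K ≤ n) :
    (steps x n u v : ℝ) - steps x K u v ≤
      (flow Δ x n u v - flow Δ x K u v) * ((cnt x n v : ℝ) + Δ) := by
  induction n, h using Nat.le_induction with
  | base => simp
  | succ n hKn ih =>
    have hw := weight_pos hΔ x n v
    have hmono : (cnt x n v : ℝ) ≤ cnt x (n + 1) v := by
      exact_mod_cast cnt_mono x v (Nat.le_succ n)
    have hf : 0 ≤ flow Δ x n u v - flow Δ x K u v := by
      have : Monotone fun n => flow Δ x n u v := monotone_nat_of_le_succ fun n => by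
        rw [flow_succ]
        refine le_add_of_nonneg_right ?_
        split_ifs
        · exact (one_div_pos.2 (weight_pos hΔ x n v)).le
        · exact le_rfl
      exact sub_nonneg.2 (this hKn)
    rw [steps_succ, flow_succ]
    split_ifs with hs
    · have h1 : 1 ≤ 1 / ((cnt x n v : ℝ) + Δ) * ((cnt x (n + 1) v : ℝ) + Δ) := by
        rw [one_div, inv_mul_eq_div, le_div_iff₀ hw]
        linarith
      push_cast
      nlinarith
    · push_cast
      nlinarith

lemma steps_isLittleO (hΔ : -1 < Δ) {u v : ℤ} (hv : v ∈ recurrentSites x)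
    (hc : Conv fun n => flow Δ x n u v) :
    (fun n => (steps x n u v : ℝ)) =o[atTop] fun n => (cnt x n v : ℝ) := by
  rw [Asymptotics.isLittleO_iff]
  intro c hc0
  obtain ⟨K, hK⟩ := Metric.cauchySeq_iff'.1 hc.choose_spec.cauchySeq (c / 2) (half_pos hc0)
  filter_upwards [eventually_ge_atTop K,
    (tendsto_cnt_real hv).eventually_ge_atTop ((steps x K u v + c / 2 * Δ) / (c / 2))] with n hn hb
  have h1 := steps_sub_le (x := x) hΔ u v hn
  have h2 := hK n hn
  rw [Real.dist_eq] at h2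
  have h3 := (abs_lt.1 h2).2
  have h4 := weight_pos hΔ x n v
  rw [div_le_iff₀ (half_pos hc0)] at hb
  rw [Real.norm_of_nonneg (Nat.cast_nonneg _), Real.norm_of_nonneg (Nat.cast_nonneg _)]
  nlinarith

/-- All but boundedly many departures from u go to u - e, and a convergent flow means that these are
a vanishing fraction of the visits to u - e. The sign e treats both ends of the interval at once. -/
lemma cnt_isLittleO_of_conv_flow (hΔ : -1 < Δ) (hx : IsNNPath x) {e : ℤ} (he : e = 1 ∨ e = -1)
    {u : ℤ} (h1 : u + e ∉ recurrentSites x) (h2 : u - e ∈ recurrentSites x)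
    (hc : Conv fun n => flow Δ x n u (u - e)) :
    (fun n => (cnt x n u : ℝ)) =o[atTop] fun n => (cnt x n (u - e) : ℝ) := by
  have hO : (fun n => (cnt x n u : ℝ) - steps x n u (u - e)) =O[atTop] fun _ => (1 : ℝ) := by
    refine Asymptotics.IsBigO.trans (Asymptotics.IsBigO.of_bound 1 (Eventually.of_forall fun n => ?_))
      ((Asymptotics.isBigO_refl (fun _ => (2 : ℝ)) atTop |>.trans
        (Asymptotics.isBigO_const_const 2 one_ne_zero _)).add (cnt_isBigO_one h1))
    have e1 := cnt_eq_steps_out' hx he n u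
    have e2 := steps_le_cnt (x := x) n u (u + e)
    have e3 : (cnt x n u : ℝ) = 1 + (if x n = u then 1 else 0) + steps x n u (u - e) +
      steps x n u (u + e) := by
      rw [e1]; push_cast; rfl
    have e4 : (steps x n u (u + e) : ℝ) ≤ cnt x n (u + e) := by exact_mod_cast e2
    have e5 : (0 : ℝ) ≤ steps x n u (u + e) := Nat.cast_nonneg _
    have e6 : (0 : ℝ) ≤ if x n = u then (1 : ℝ) else 0 := by split_ifs <;> norm_num
    have e7 : (if x n = u then (1 : ℝ) else 0) ≤ 1 := by split_ifs <;> norm_num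
    rw [one_mul, Real.norm_of_nonneg (by linarith), Real.norm_of_nonneg (by linarith)]
    linarith
  have h := (hO.trans_isLittleO (one_isLittleO_cnt h2)).add (steps_isLittleO hΔ h2 hc)
  simpa using h

lemma tendsto_ratio_of_conv_log {u v : ℤ}
    (h : Conv fun n => Real.log (cnt x n u) - Real.log (cnt x n v)) :
    ∃ ρ : ℝ, 0 < ρ ∧ Tendsto (fun n => (cnt x n u : ℝ) / cnt x n v) atTop (𝓝 ρ) := by
  obtain ⟨c, hc⟩ := h
  refine ⟨Real.exp c, Real.exp_pos c, ((Real.continuous_exp.tendsto c).comp hc).congr fun n => ?_⟩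
  have h1 : (0 : ℝ) < cnt x n u := by exact_mod_cast one_le_cnt x n u
  have h2 : (0 : ℝ) < cnt x n v := by exact_mod_cast one_le_cnt x n v
  simp only [Function.comp]
  rw [Real.exp_sub, Real.exp_log h1, Real.exp_log h2]

variable (hΔ : -1 < Δ) (hx : IsNNPath x) (hM : ∀ v, Conv fun n => flowDiff Δ x n v)
include hΔ hx hM

lemma recurrentSites_not_four {a : ℤ} (h0 : a - 1 ∉ recurrentSites x)
    (h1 : a ∈ recurrentSites x) (h2 : a + 1 ∈ recurrentSites x) (h3 : a + 2 ∈ recurrentSites x)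
    (h4 : a + 3 ∈ recurrentSites x) (h5 : a + 4 ∉ recurrentSites x) : False := by
  have y0 := conv_upFlow_of_notMem hM h0 (w := a - 1) (by omega)
  have y1 := conv_upFlow_of_notMem hM h0 (w := a) (by omega)
  have y3 := conv_upFlow_of_notMem hM h5 (w := a + 3) (by omega)
  have y4 := conv_upFlow_of_notMem hM h5 (w := a + 4) (by omega)
  have l1 := conv_log_cnt_sub_upFlow hΔ hx hM h1
  have l2 := conv_log_cnt_sub_upFlow hΔ hx hM h2
  have l3 := conv_log_cnt_sub_upFlow hΔ hx hM h3
  have l4 := conv_log_cnt_sub_upFlow hΔ hx hM h4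
  have f3 := conv_upFlow_sub_downFlow hM (a + 2)
  rw [show a + 1 - 1 = a by ring, show a + 1 + 1 = a + 2 by ring] at l2
  rw [show a + 2 - 1 = a + 1 by ring, show a + 2 + 1 = a + 3 by ring] at l3
  rw [show a + 3 - 1 = a + 2 by ring, show a + 3 + 1 = a + 4 by ring] at l4
  rw [show a + 2 + 1 = a + 3 by ring] at f3
  obtain ⟨ρ, hρ, hρ'⟩ := tendsto_ratio_of_conv_log (x := x) (u := a) (v := a + 2)
    (((l1.sub l3).add (y0.sub y3)).congr fun n => by ring)
  obtain ⟨σ, hσ, hσ'⟩ := tendsto_ratio_of_conv_log (x := x) (u := a + 3) (v := a + 1)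
    (((l4.sub l2).add (y4.sub y1)).congr fun n => by ring)
  have o1 := cnt_isLittleO_of_conv_flow hΔ hx (e := -1) (Or.inr rfl) (u := a) h0
    (by rwa [sub_neg_eq_add]) (by rw [sub_neg_eq_add]; exact y1)
  have o2 := cnt_isLittleO_of_conv_flow hΔ hx (e := 1) (Or.inl rfl) (u := a + 3)
    (by rwa [show a + 3 + 1 = a + 4 by ring]) (by rwa [show a + 3 - 1 = a + 2 by ring])
    (by
      rw [show a + 3 - 1 = a + 2 by ring]
      exact (y3.sub f3).congr fun n => by ring)
  rw [sub_neg_eq_add] at o1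
  rw [show a + 3 - 1 = a + 2 by ring] at o2
  -- The same product, Z(a) Z(a+3) / (Z(a+1) Z(a+2)), is grouped in two ways: one gives limit 0, the
  -- other ρσ > 0.
  have t := (o1.tendsto_div_nhds_zero.mul o2.tendsto_div_nhds_zero).congr
    (f₂ := fun n => (cnt x n a : ℝ) / cnt x n (a + 2) * (cnt x n (a + 3) / cnt x n (a + 1)))
    fun n => by rw [div_mul_div_comm, div_mul_div_comm, mul_comm (cnt x n (a + 1) : ℝ)]
  rw [mul_zero] at t
  exact (mul_pos hρ hσ).ne (tendsto_nhds_unique t (hρ'.mul hσ'))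

/-- If the path has recurrent sites, it has at least five. -/
theorem five_le_encard_recurrentSites (hne : (recurrentSites x).Nonempty) :
    5 ≤ (recurrentSites x).encard := by
  by_contra hlt
  rw [not_le] at hlt
  have hfin : (recurrentSites x).Finite := Set.encard_lt_top_iff.1 (hlt.trans (by decide))
  obtain ⟨a, ha, hamin⟩ := Set.exists_min_image _ id hfin hne
  obtain ⟨b, hb, hbmax⟩ := Set.exists_max_image _ id hfin hne
  simp only [id] at hamin hbmax
  have hab : a ≤ b := hamin b hb
  have ha' : a - 1 ∉ recurrentSites x := fun h => by have := hamin _ h; omega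
  have hb' : b + 1 ∉ recurrentSites x := fun h => by have := hbmax _ h; omega
  have hmem : ∀ c, a ≤ c → c ≤ b → c ∈ recurrentSites x := fun c h1 h2 =>
    mem_recurrentSites_of_between hx ha hb h1 h2
  have hba : b < a + 4 := by
    by_contra hba
    have hsub : ((Finset.Icc a (a + 4) : Finset ℤ) : Set ℤ) ⊆ recurrentSites x := fun c hc => by
      rw [Finset.coe_Icc, Set.mem_Icc] at hc
      exact hmem c hc.1 (by omega)
    have h := Set.encard_le_encard hsub
    rw [Set.encard_coe_eq_coe_finsetCard, Int.card_Icc, show a + 4 + 1 - a = 5 by ring] at h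
    exact absurd hlt (not_lt.2 h)
  have ya := fun w hw => conv_upFlow_of_notMem hM ha' (w := w) hw
  have yb := fun w hw => conv_upFlow_of_notMem hM hb' (w := w) hw
  -- With at most three sites, the site a (or the middle one, when b = a + 2) has both neighbours
  -- within distance one of a nonrecurrent site.
  rcases (by omega : b = a ∨ b = a + 1 ∨ b = a + 2 ∨ b = a + 3) with h | h | h | h
  · exact not_conv_upFlow_both hΔ hx hM ha (ya _ (by omega)) (yb _ (by omega))
  · exact not_conv_upFlow_both hΔ hx hM ha (ya _ (by omega)) (yb _ (by omega))
  · exact not_conv_upFlow_both hΔ hx hM (hmem (a + 1) (by omega) (by omega)) (ya _ (by omega))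
      (yb _ (by omega))
  · refine recurrentSites_not_four hΔ hx hM ha' ha (hmem _ ?_ ?_) (hmem _ ?_ ?_) (hmem _ ?_ ?_) ?_
    all_goals first | omega | exact fun h' => by have := hbmax _ h'; omega

end Path

/-! ### Summation by parts and five recurrent sites -/

lemma sum_sub_mul_eq (E g : ℕ → ℝ) (n : ℕ) :
    ∑ k ∈ Finset.range n, (E (k + 1) - E k) * g k =
      E n * g n - E 0 * g 0 + ∑ k ∈ Finset.range n, E (k + 1) * (g k - g (k + 1)) := by
  induction n with
  | zero => simp
  | succ n ih => rw [Finset.sum_range_succ, Finset.sum_range_succ, ih]; ring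

section Path

variable {Δ : ℝ} {x : ℕ → ℤ}

lemma flow_eq_sum (n : ℕ) (u v : ℤ) :
    flow Δ x n u v = ∑ k ∈ Finset.range n,
      ((steps x (k + 1) u v : ℝ) - steps x k u v) * (1 / ((cnt x k v : ℝ) + Δ)) := by
  refine Finset.sum_congr rfl fun k _ => ?_
  rw [steps_succ]
  split_ifs <;> simp

lemma recipSum_sub_eq_sum (n : ℕ) (v : ℤ) :
    recipSum Δ (cnt x n v) - recipSum Δ (cnt x 0 v) = ∑ k ∈ Finset.range n,
      ((cnt x (k + 1) v : ℝ) - cnt x k v) * (1 / ((cnt x k v : ℝ) + Δ)) := by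
  induction n with
  | zero => simp
  | succ n ih =>
    rw [Finset.sum_range_succ, ← ih, cnt_succ]
    split_ifs
    · rw [recipSum, Finset.sum_range_succ, ← recipSum]; push_cast; ring
    · simp

lemma tendsto_cnt_div_weight {v : ℤ} (hv : v ∈ recurrentSites x) :
    Tendsto (fun n => (cnt x n v : ℝ) * (1 / ((cnt x n v : ℝ) + Δ))) atTop (𝓝 1) := by
  have h : Tendsto (fun t : ℝ => t * (1 / (t + Δ))) atTop (𝓝 1) := by
    have h1 : Tendsto (fun t : ℝ => 1 - Δ * (t + Δ)⁻¹) atTop (𝓝 (1 - Δ * 0)) :=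
      tendsto_const_nhds.sub ((tendsto_inv_atTop_zero.comp
        (tendsto_atTop_add_const_right _ Δ tendsto_id)).const_mul Δ)
    rw [mul_zero, sub_zero] at h1
    refine h1.congr' ?_
    filter_upwards [eventually_gt_atTop (-Δ)] with t ht
    have : t + Δ ≠ 0 := by linarith
    field_simp
    ring
  exact h.comp (tendsto_cnt_real hv)

lemma one_isLittleO_log_cnt {v : ℤ} (hv : v ∈ recurrentSites x) :
    (fun _ => (1 : ℝ)) =o[atTop] fun n => Real.log (cnt x n v) :=
  Asymptotics.isLittleO_const_left.2 (Or.inr (tendsto_norm_atTop_atTop.comp (tendsto_log_cnt hv)))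

lemma conv_recipSum_cnt (hΔ : -1 < Δ) {v : ℤ} (hv : v ∈ recurrentSites x) :
    Conv fun n => recipSum Δ (cnt x n v) - Real.log (cnt x n v) := by
  obtain ⟨c, hc⟩ := conv_recipSum_sub_log hΔ
  exact ⟨c, hc.comp (tendsto_cnt hv)⟩

/-- If a fraction `α` of the steps into `v` come from `u`, then the flow from `u` to `v` is
asymptotic to `α` times the logarithm of the number of visits to `v`. -/
lemma tendsto_flow_div_log (hΔ : -1 < Δ) {u v : ℤ} {α : ℝ} (hv : v ∈ recurrentSites x)
    (hα : Tendsto (fun n => (steps x n u v : ℝ) / cnt x n v) atTop (𝓝 α)) :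
    Tendsto (fun n => flow Δ x n u v / Real.log (cnt x n v)) atTop (𝓝 α) := by
  set Z : ℕ → ℝ := fun n => cnt x n v
  set g : ℕ → ℝ := fun n => 1 / (Z n + Δ)
  -- The error E is o(Z). Summation by parts moves the differences onto the decreasing sequence g,
  -- so this estimate can be used termwise with nonnegative coefficients.
  set E : ℕ → ℝ := fun n => steps x n u v - α * Z n
  set L : ℕ → ℝ := fun n => Real.log (Z n)
  set R : ℕ → ℝ := fun n => recipSum Δ (cnt x n v) - recipSum Δ (cnt x 0 v)
  have hZpos : ∀ n, 0 < Z n := fun n => by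
    have := one_le_cnt x n v
    simp only [Z]
    positivity
  have hL : Tendsto L atTop atTop := tendsto_log_cnt hv
  have h1L : (fun _ => (1 : ℝ)) =o[atTop] L := one_isLittleO_log_cnt hv
  have hEZ : E =o[atTop] Z := by
    rw [Asymptotics.isLittleO_iff_tendsto fun n h => absurd h (hZpos n).ne']
    have := hα.sub_const α
    rw [sub_self] at this
    refine this.congr fun n => ?_
    have := (hZpos n).ne'
    simp only [E]
    rw [sub_div, mul_div_cancel_right₀ _ this]
  have hZg : Tendsto (fun n => Z n * g n) atTop (𝓝 1) := tendsto_cnt_div_weight hv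
  have hganti : ∀ n, 0 ≤ g n - g (n + 1) := fun n => by
    refine sub_nonneg.2 (one_div_le_one_div_of_le (weight_pos hΔ x n v) ?_)
    have : Z n ≤ Z (n + 1) := by
      have := cnt_mono x v (Nat.le_succ n)
      simp only [Z]
      exact_mod_cast this
    linarith
  have hRsum : ∀ n, R n = Z n * g n - Z 0 * g 0 +
      ∑ k ∈ Finset.range n, Z (k + 1) * (g k - g (k + 1)) := fun n => by
    rw [← sum_sub_mul_eq]
    exact recipSum_sub_eq_sum n v
  have hEsum : ∀ n, flow Δ x n u v - α * R n = E n * g n - E 0 * g 0 +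
      ∑ k ∈ Finset.range n, E (k + 1) * (g k - g (k + 1)) := fun n => by
    rw [← sum_sub_mul_eq, flow_eq_sum, show R n = _ from recipSum_sub_eq_sum n v, Finset.mul_sum,
      ← Finset.sum_sub_distrib]
    refine Finset.sum_congr rfl fun k _ => ?_
    simp only [E, Z, g]
    ring
  have hRL : Conv fun n => R n - L n :=
    ((conv_recipSum_cnt hΔ hv).sub (conv_const (recipSum Δ (cnt x 0 v)))).congr fun n => by
      simp only [R, L, Z]; ring
  -- The same summation by parts with Z in place of E identifies the comparison sum as log Z up to a
  -- convergent term.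
  have hB : Conv fun n => ∑ k ∈ Finset.range n, Z (k + 1) * (g k - g (k + 1)) - L n :=
    ((hRL.sub ⟨1, hZg⟩).add (conv_const (Z 0 * g 0))).congr fun n => by rw [hRsum]; ring
  have hBtop : Tendsto (fun n => ∑ k ∈ Finset.range n, Z (k + 1) * (g k - g (k + 1)))
      atTop atTop :=
    (hL.atTop_add hB.choose_spec).congr fun n => by ring
  have hBO : (fun n => ∑ k ∈ Finset.range n, Z (k + 1) * (g k - g (k + 1))) =O[atTop] L := by
    have := ((hB.choose_spec.isBigO_one ℝ).trans_isLittleO h1L).isBigO.add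
      (Asymptotics.isBigO_refl L atTop)
    simpa using this
  have hS : (fun n => ∑ k ∈ Finset.range n, E (k + 1) * (g k - g (k + 1))) =o[atTop] L := by
    refine Asymptotics.IsLittleO.trans_isBigO (Asymptotics.IsLittleO.sum_range ?_ ?_ hBtop) hBO
    · exact (hEZ.comp_tendsto (tendsto_add_atTop_nat 1)).mul_isBigO (Asymptotics.isBigO_refl _ _)
    · exact fun n => mul_nonneg (hZpos _).le (hganti n)
  have hEg : (fun n => E n * g n) =o[atTop] L := by
    have h := (hEZ.mul_isBigO (Asymptotics.isBigO_refl g atTop)).trans_isBigO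
      (hZg.isBigO_one ℝ)
    exact h.trans h1L
  have hE0 : (fun _ : ℕ => E 0 * g 0) =o[atTop] L :=
    (Asymptotics.isBigO_const_const _ one_ne_zero _).trans_isLittleO h1L
  have hR : (fun n => R n - L n) =o[atTop] L := (hRL.choose_spec.isBigO_one ℝ).trans_isLittleO h1L
  have hfinal : (fun n => flow Δ x n u v - α * L n) =o[atTop] L := by
    refine (((hEg.sub hE0).add hS).add (hR.const_mul_left α)).congr_left fun n => ?_
    rw [← hEsum]
    ring
  have := hfinal.tendsto_div_nhds_zero.add_const α
  rw [zero_add] at this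
  refine this.congr' ?_
  filter_upwards [hL.eventually_gt_atTop 0] with n hn
  rw [sub_div, mul_div_cancel_right₀ _ hn.ne', sub_add_cancel]

/-- Departures from c ± e that avoid c are visits to c ± 2e, hence o(Z(c)). So the steps from c ± e
to c number Z(c ± e) up to o(Z(c)), and Z(c-e) + Z(c+e) is asymptotic to Z(c). -/
lemma tendsto_steps_div_cnt (hx : IsNNPath x) {e : ℤ} (he : e = 1 ∨ e = -1) {c : ℤ} {α : ℝ}
    (hc : c ∈ recurrentSites x)
    (hα : Tendsto (fun n => (cnt x n (c + e) : ℝ) / (cnt x n (c - e) + cnt x n (c + e)))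
      atTop (𝓝 α))
    (h1 : (fun n => (cnt x n (c + 2 * e) : ℝ)) =o[atTop] fun n => (cnt x n c : ℝ))
    (h2 : (fun n => (cnt x n (c - 2 * e) : ℝ)) =o[atTop] fun n => (cnt x n c : ℝ)) :
    Tendsto (fun n => (steps x n (c + e) c : ℝ) / cnt x n c) atTop (𝓝 α) := by
  have hone := one_isLittleO_cnt hc
  have key : ∀ e : ℤ, (e = 1 ∨ e = -1) →
      ((fun n => (cnt x n (c + 2 * e) : ℝ)) =o[atTop] fun n => (cnt x n c : ℝ)) →
      (fun n => (cnt x n (c + e) : ℝ) - steps x n (c + e) c) =o[atTop]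
        fun n => (cnt x n c : ℝ) := by
    intro e he h
    refine Asymptotics.IsBigO.trans_isLittleO (Asymptotics.IsBigO.of_bound 1
      (Eventually.of_forall fun n => ?_)) ((hone.const_mul_left 2).add h)
    have e1 := cnt_eq_steps_out' hx he n (c + e)
    have e2 := steps_le_cnt (x := x) n (c + e) (c + e + e)
    rw [add_sub_cancel_right] at e1
    rw [show c + 2 * e = c + e + e by ring]
    have e3 : (cnt x n (c + e) : ℝ) = 1 + (if x n = c + e then 1 else 0) + steps x n (c + e) c +
        steps x n (c + e) (c + e + e) := by
      rw [e1]; push_cast; rfl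
    have e4 : (steps x n (c + e) (c + e + e) : ℝ) ≤ cnt x n (c + e + e) := by exact_mod_cast e2
    have e5 : (0 : ℝ) ≤ steps x n (c + e) (c + e + e) := Nat.cast_nonneg _
    have e6 : (0 : ℝ) ≤ if x n = c + e then (1 : ℝ) else 0 := by split_ifs <;> norm_num
    have e7 : (if x n = c + e then (1 : ℝ) else 0) ≤ 1 := by split_ifs <;> norm_num
    rw [one_mul, Real.norm_of_nonneg (by linarith), Real.norm_of_nonneg (by linarith)]
    linarith
  have k1 := key e he h1
  have k2 := key (-e) (by omega) (by rw [mul_neg, ← sub_eq_add_neg]; exact h2)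
  rw [← sub_eq_add_neg] at k2
  have k3 : (fun n => (cnt x n (c - e) : ℝ) + cnt x n (c + e) - cnt x n c) =o[atTop]
      fun n => (cnt x n c : ℝ) := by
    refine ((k1.add k2).sub (hone.const_mul_left (cnt x 0 c : ℝ))).congr_left fun n => ?_
    have : (cnt x n c : ℝ) = cnt x 0 c + steps x n (c - e) c + steps x n (c + e) c := by
      exact_mod_cast cnt_eq_steps_in' hx he n c
    rw [this]
    ring
  have hpos : ∀ v n, (0 : ℝ) < cnt x n v := fun v n => by exact_mod_cast one_le_cnt x n v
  have t3 : Tendsto (fun n => ((cnt x n (c - e) : ℝ) + cnt x n (c + e)) / cnt x n c)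
      atTop (𝓝 1) := by
    have := k3.tendsto_div_nhds_zero.add_const 1
    rw [zero_add] at this
    refine this.congr fun n => ?_
    rw [sub_div, div_self (hpos c n).ne', sub_add_cancel]
  have t := (hα.mul t3).sub k1.tendsto_div_nhds_zero
  rw [mul_one, sub_zero] at t
  refine t.congr fun n => ?_
  have := hpos c n
  have := hpos (c - e) n
  have := hpos (c + e) n
  field_simp
  ring

lemma isLittleO_of_conv_log {a b c : ℤ} (ha : a ∈ recurrentSites x)
    (h : Conv fun n => Real.log (cnt x n a) + Real.log (cnt x n b) - Real.log (cnt x n c)) :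
    (fun n => (cnt x n b : ℝ)) =o[atTop] fun n => (cnt x n c : ℝ) := by
  have hpos : ∀ v n, (0 : ℝ) < cnt x n v := fun v n => by exact_mod_cast one_le_cnt x n v
  rw [Asymptotics.isLittleO_iff_tendsto fun n h => absurd h (hpos c n).ne']
  have h1 : Tendsto (fun n => Real.log (cnt x n b) - Real.log (cnt x n c)) atTop atBot :=
    (h.choose_spec.add_atBot (tendsto_neg_atTop_atBot.comp (tendsto_log_cnt ha))).congr fun n => by
      simp only [Function.comp]; ring
  refine (Real.tendsto_exp_atBot.comp h1).congr fun n => ?_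
  simp only [Function.comp]
  rw [Real.exp_sub, Real.exp_log (hpos b n), Real.exp_log (hpos c n)]

variable (hΔ : -1 < Δ) (hx : IsNNPath x) (hM : ∀ v, Conv fun n => flowDiff Δ x n v)
include hΔ hx hM

/-- The asymptotics of the numbers of visits of a path with exactly five recurrent sites. -/
theorem tendsto_log_ratio_of_five {c : ℤ}
    (h : recurrentSites x = {c - 2, c - 1, c, c + 1, c + 2}) :
    ∃ αm αp : ℝ, αm ∈ Set.Ioo (0 : ℝ) 1 ∧
      Tendsto (fun n => (cnt x n (c - 1) : ℝ) / (cnt x n (c - 1) + cnt x n (c + 1)))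
        atTop (𝓝 αm) ∧
      Tendsto (fun n => (cnt x n (c + 1) : ℝ) / (cnt x n (c - 1) + cnt x n (c + 1)))
        atTop (𝓝 αp) ∧
      Tendsto (fun n => Real.log (cnt x n (c - 2)) / Real.log (cnt x n c)) atTop (𝓝 αm) ∧
      Tendsto (fun n => Real.log (cnt x n (c + 2)) / Real.log (cnt x n c)) atTop (𝓝 αp) := by
  have hmem : ∀ v, v ∈ recurrentSites x ↔ c - 2 ≤ v ∧ v ≤ c + 2 := fun v => by
    rw [h]
    simp only [Set.mem_insert_iff, Set.mem_singleton_iff]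
    omega
  have hleft : c - 3 ∉ recurrentSites x := by rw [hmem]; omega
  have hright : c + 3 ∉ recurrentSites x := by rw [hmem]; omega
  have hc : c ∈ recurrentSites x := by rw [hmem]; omega
  have hpos : ∀ v n, (0 : ℝ) < cnt x n v := fun v n => by exact_mod_cast one_le_cnt x n v
  have yl := fun w hw => conv_upFlow_of_notMem hM hleft (w := w) hw
  have yr := fun w hw => conv_upFlow_of_notMem hM hright (w := w) hw
  have l := fun v hv => conv_log_cnt_sub_upFlow hΔ hx hM ((hmem v).2 hv)
  have ll := l (c - 2) (by omega)
  have lm := l (c - 1) (by omega)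
  have l0 := l c (by omega)
  have lp := l (c + 1) (by omega)
  have lr := l (c + 2) (by omega)
  rw [show c - 2 + 1 = c - 1 by ring] at ll
  rw [show c - 1 - 1 = c - 2 by ring, show c - 1 + 1 = c by ring] at lm
  rw [show c + 1 - 1 = c by ring, show c + 1 + 1 = c + 2 by ring] at lp
  rw [show c + 2 - 1 = c + 1 by ring] at lr
  have ll' : Conv fun n => Real.log (cnt x n (c - 2)) - upFlow Δ x n (c - 1) :=
    (ll.add (yl (c - 2 - 1) (by omega))).congr fun n => by ring
  have lr' : Conv fun n => Real.log (cnt x n (c + 2)) - upFlow Δ x n (c + 1) :=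
    (lr.add (yr (c + 2 + 1) (by omega))).congr fun n => by ring
  have hsum : Conv fun n =>
      Real.log (cnt x n (c - 2)) + Real.log (cnt x n (c + 2)) - Real.log (cnt x n c) :=
    ((ll'.add lr').sub l0).congr fun n => by ring
  have or : (fun n => (cnt x n (c + 2) : ℝ)) =o[atTop] fun n => (cnt x n c : ℝ) :=
    isLittleO_of_conv_log ((hmem (c - 2)).2 (by omega)) hsum
  have ol : (fun n => (cnt x n (c - 2) : ℝ)) =o[atTop] fun n => (cnt x n c : ℝ) :=
    isLittleO_of_conv_log ((hmem (c + 2)).2 (by omega)) (hsum.congr fun n => by ring)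
  -- Both logarithms equal the flow out of c to the right, up to convergent terms; α⁻ = 1/(1+ρ) then
  -- lies strictly between 0 and 1.
  obtain ⟨ρ, hρ, hρ'⟩ := tendsto_ratio_of_conv_log (x := x) (u := c + 1) (v := c - 1)
    (((lp.sub lm).add ((yr (c + 2) (by omega)).sub (yl (c - 2) (by omega)))).congr
      fun n => by ring)
  have tm : Tendsto (fun n => (cnt x n (c - 1) : ℝ) / (cnt x n (c - 1) + cnt x n (c + 1)))
      atTop (𝓝 (1 / (1 + ρ))) := by
    refine (tendsto_const_nhds.div (hρ'.const_add 1) (by positivity)).congr fun n => ?_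
    have := hpos (c - 1) n
    have := hpos (c + 1) n
    simp only [Pi.div_apply]
    field_simp
  have tp : Tendsto (fun n => (cnt x n (c + 1) : ℝ) / (cnt x n (c - 1) + cnt x n (c + 1)))
      atTop (𝓝 (1 - 1 / (1 + ρ))) := by
    refine (tm.const_sub 1).congr fun n => ?_
    have := hpos (c - 1) n
    have := hpos (c + 1) n
    field_simp
    ring
  have hend : ∀ {e : ℤ} {α : ℝ}, Tendsto (fun n => flow Δ x n (c + e) c / Real.log (cnt x n c))
      atTop (𝓝 α) → Conv (fun n => Real.log (cnt x n (c + 2 * e)) - flow Δ x n (c + e) c) →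
      Tendsto (fun n => Real.log (cnt x n (c + 2 * e)) / Real.log (cnt x n c)) atTop (𝓝 α) := by
    intro e α h1 h2
    have := h1.add (h2.choose_spec.div_atTop (tendsto_log_cnt hc))
    rw [add_zero] at this
    refine this.congr fun n => ?_
    rw [← add_div]
    ring
  refine ⟨1 / (1 + ρ), 1 - 1 / (1 + ρ), ⟨by positivity, ?_⟩, tm, tp, ?_, ?_⟩
  · rw [div_lt_one (by positivity)]
    linarith
  · have t := hend (e := -1) (tendsto_flow_div_log hΔ hc (tendsto_steps_div_cnt hx (Or.inr rfl) hc
      (α := 1 / (1 + ρ))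
      (by
        rw [sub_neg_eq_add, ← sub_eq_add_neg]
        exact tm.congr fun n => by rw [add_comm (cnt x n (c - 1) : ℝ)])
      (by rw [show c + 2 * -1 = c - 2 by ring]; exact ol)
      (by rw [show c - 2 * -1 = c + 2 by ring]; exact or))) (by
        rw [show c + 2 * -1 = c - 2 by ring, ← sub_eq_add_neg]
        refine ll'.congr fun n => ?_
        rw [upFlow, sub_add_cancel])
    rwa [show c + 2 * -1 = c - 2 by ring] at t
  · have t := hend (e := 1) (tendsto_flow_div_log hΔ hc (tendsto_steps_div_cnt hx (Or.inl rfl) hc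
      tp (by rw [mul_one]; exact or) (by rw [mul_one]; exact ol))) (by
        rw [mul_one]
        exact (lr'.add (conv_upFlow_sub_downFlow hM c)).congr fun n => by ring)
    rwa [mul_one] at t

end Path

/-! ### The potential bounding the chance of visiting v + 3 -/

lemma drift_zero {x Y y r : ℝ} (hx : 0 < x) (hY : 0 < Y) (hy : Y + 1 ≤ y) :
    y / (y + x) * (x / (4 * (Y + 1)) + r) + x / (y + x) * ((x + 1) / (4 * Y) + r) ≤
      x / (4 * Y) + r := by
  have hyp : 0 < y := by linarith
  have e : x / (4 * Y) + r -
      (y / (y + x) * (x / (4 * (Y + 1)) + r) + x / (y + x) * ((x + 1) / (4 * Y) + r)) =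
      x * (y - (Y + 1)) / (4 * Y * (Y + 1) * (y + x)) := by
    field_simp
    ring
  have : 0 ≤ x * (y - (Y + 1)) / (4 * Y * (Y + 1) * (y + x)) :=
    div_nonneg (mul_nonneg hx.le (by linarith)) (by positivity)
  linarith

/-- At v+1: a step left increases N and so lowers the term in u/N. This gain pays for the growth of
u on a step right and for the surcharge (2+Δ)/x at v+2; x < 4Y ensures that the weight w of v is
large enough. -/
lemma drift_one {Δ x Y w u N : ℝ} (hΔ : -1 < Δ) (hY : 0 < Y) (hN : 0 < N) (hw : Y + N + 1 ≤ w)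
    (hu : 0 < u) (hx : N + 1 ≤ x) (h : x / (4 * Y) < 1) :
    w / (w + u) * (x / (4 * Y) + 4 * (2 + Δ) * u / (N + 1)) +
      u / (w + u) * (x / (4 * Y) + 4 * (2 + Δ) * (u + 1) / N + (2 + Δ) / x) ≤
      x / (4 * Y) + 4 * (2 + Δ) * u / N := by
  have hx0 : 0 < x := by linarith
  have hw0 : 0 < w := by linarith
  have hD : 0 < 2 + Δ := by linarith
  rw [div_lt_one (by positivity)] at h
  have e : x / (4 * Y) + 4 * (2 + Δ) * u / N -
      (w / (w + u) * (x / (4 * Y) + 4 * (2 + Δ) * u / (N + 1)) +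
        u / (w + u) * (x / (4 * Y) + 4 * (2 + Δ) * (u + 1) / N + (2 + Δ) / x)) =
      (2 + Δ) * u * (4 * x * (w - (N + 1)) - N * (N + 1)) / (N * (N + 1) * x * (w + u)) := by
    field_simp
    ring
  have h1 : N * (N + 1) ≤ 4 * x * (w - (N + 1)) := by
    have h2 : x ≤ 4 * (w - (N + 1)) := by linarith
    nlinarith
  have : 0 ≤ (2 + Δ) * u * (4 * x * (w - (N + 1)) - N * (N + 1)) / (N * (N + 1) * x * (w + u)) :=
    div_nonneg (mul_nonneg (by positivity) (by linarith)) (by positivity)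
  linarith

/-- At v+2: the surcharge (2+Δ)/x splits as (1+Δ)/x, for the chance of a first visit to v+3, plus
1/x, for the growth of x/(4Y) on a step back. -/
lemma drift_two {Δ x Y B : ℝ} (hΔ : -1 < Δ) (hx : 0 < x) (hY : 0 < Y) (hB : 0 ≤ B)
    (h : x / (4 * Y) < 1) :
    x / (x + (1 + Δ)) * ((x + 1) / (4 * Y) + B) + (1 + Δ) / (x + (1 + Δ)) * 1 ≤
      x / (4 * Y) + B + (2 + Δ) / x := by
  have hD : 0 < 1 + Δ := by linarith
  rw [div_lt_one (by positivity)] at h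
  have h1 : x / (x + (1 + Δ)) ≤ 1 := (div_le_one (by positivity)).2 (by linarith)
  have h2 : (1 + Δ) / (x + (1 + Δ)) ≤ (1 + Δ) / x :=
    div_le_div_of_nonneg_left hD.le hx (by linarith)
  have h3 : 1 / (4 * Y) ≤ 1 / x := one_div_le_one_div_of_le hx h.le
  have h4 : 0 ≤ (x + 1) / (4 * Y) + B := by positivity
  have h5 := mul_le_of_le_one_left h4 h1
  have h6 : (x + 1) / (4 * Y) = x / (4 * Y) + 1 / (4 * Y) := add_div _ _ _
  have h7 : (2 + Δ) / x = (1 + Δ) / x + 1 / x := by rw [← add_div]; ring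
  linarith

/-- A bound for the probability that the walk visits `v + 3`, when its position is `v + pos`, it
has made `l` steps from `v` to `v - 1` and `N` from `v + 1` to `v`, and `q`, `p`, `f` are one
plus the numbers of visits to `v + 1`, `v + 2`, `v + 3`. -/
noncomputable def potential (Δ : ℝ) (m : ℕ) (pos : ℤ) (l N q p f : ℕ) : ℝ :=
  if f ≠ 1 then 1
  else if N < m then
    if p ≠ 1 then 1
    else if pos ≤ 0 ∧ l = N then 1 - 1 / 4 * (4 ^ N / 4 ^ m)
    else if pos ≤ 1 ∧ N < l then 1 - 2 * (1 / 4 * (4 ^ N / 4 ^ m))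
    else 1
  else min 1 (((q : ℝ) + Δ) / (4 * ((l : ℝ) + 1 + Δ)) + 4 * (2 + Δ) * ((p : ℝ) + Δ) / N +
    if pos = 2 then (2 + Δ) / ((q : ℝ) + Δ) else 0)

section Potential

variable {Δ : ℝ} {m : ℕ} {pos : ℤ} {l N q p f : ℕ}

lemma potential_le_one : potential Δ m pos l N q p f ≤ 1 := by
  unfold potential
  have : (0 : ℝ) ≤ 1 / 4 * (4 ^ N / 4 ^ m) := by positivity
  split_ifs <;> first | exact le_rfl | exact min_le_left _ _ | linarith

lemma cast_add_pos (hΔ : -1 < Δ) {a : ℕ} (ha : 1 ≤ a) : 0 < (a : ℝ) + Δ := by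
  have : (1 : ℝ) ≤ a := by exact_mod_cast ha
  linarith

lemma potential_nonneg (hΔ : -1 < Δ) (hq : 1 ≤ q) (hp : 1 ≤ p) :
    0 ≤ potential Δ m pos l N q p f := by
  unfold potential
  have h1 : N < m → (4 : ℝ) ^ N / 4 ^ m ≤ 1 := fun h =>
    div_le_one_of_le₀ (pow_le_pow_right₀ (by norm_num) h.le) (by positivity)
  have hq' := cast_add_pos hΔ hq
  have hp' := cast_add_pos hΔ hp
  have hl : 0 < (l : ℝ) + 1 + Δ := by have : (0 : ℝ) ≤ l := Nat.cast_nonneg l; linarith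
  have hD : 0 < 2 + Δ := by linarith
  split_ifs with a b
  any_goals first | exact zero_le_one | (have := h1 b; linarith)
  all_goals exact le_min zero_le_one (by positivity)

lemma potential_of_ne (h : f ≠ 1) : potential Δ m pos l N q p f = 1 := if_pos h

/-- In the warm-up N < m, only the scenario in which v+2 is unvisited and steps left from v keep
ahead of returns from v+1 has potential below 1. Its gap below 1 doubles when l passes N, and again
on the next return to v, giving the factor 4 per unit of N. -/
lemma potential_warm_eq (hN : N < m) (hpos : pos ≤ 0) :
    potential Δ m pos N N q 1 1 = 1 - 1 / 4 * (4 ^ N / 4 ^ m) := by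
  unfold potential
  rw [if_neg (by simp), if_pos hN, if_neg (by simp), if_pos ⟨hpos, rfl⟩]

lemma potential_warm_lt (hN : N < m) (hpos : pos ≤ 1) (hl : N < l) :
    potential Δ m pos l N q 1 1 = 1 - 2 * (1 / 4 * (4 ^ N / 4 ^ m)) := by
  unfold potential
  rw [if_neg (by simp), if_pos hN, if_neg (by simp), if_neg (by omega), if_pos ⟨hpos, hl⟩]

lemma potential_warm_eq_one (hN : N < m) (h : p ≠ 1 ∨ l < N ∨ (0 < pos ∧ l = N) ∨ 1 < pos) :
    potential Δ m pos l N q p f = 1 := by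
  unfold potential
  split_ifs <;> first | rfl | omega

lemma potential_late (hN : m ≤ N) : potential Δ m pos l N q p 1 =
    min 1 (((q : ℝ) + Δ) / (4 * ((l : ℝ) + 1 + Δ)) + 4 * (2 + Δ) * ((p : ℝ) + Δ) / N +
      if pos = 2 then (2 + Δ) / ((q : ℝ) + Δ) else 0) := by
  unfold potential
  rw [if_neg (by simp), if_neg (not_lt.2 hN)]

lemma avg_le_one {s t A B : ℝ} (hs : 0 ≤ s) (ht : 0 ≤ t) (hst : s + t = 1) (hA : A ≤ 1)
    (hB : B ≤ 1) : s * A + t * B ≤ 1 := by nlinarith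

lemma potential_step_zero (hΔ : -1 < Δ) {a : ℕ} (ha : l + 2 ≤ a) (hq : 1 ≤ q)
    (hpq : p = 1 → q = 1 + N) :
    ((a : ℝ) + Δ) / (((a : ℝ) + Δ) + ((q : ℝ) + Δ)) * potential Δ m (-1) (l + 1) N q p f +
      ((q : ℝ) + Δ) / (((a : ℝ) + Δ) + ((q : ℝ) + Δ)) * potential Δ m 1 l N (q + 1) p f ≤
      potential Δ m 0 l N q p f := by
  have hx := cast_add_pos hΔ hq
  have hl0 : (0 : ℝ) ≤ l := Nat.cast_nonneg l
  have ha' : (l : ℝ) + 2 ≤ a := by exact_mod_cast ha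
  set y := (a : ℝ) + Δ with hy
  set w := (q : ℝ) + Δ with hw
  have hypos : 0 < y := by linarith
  have hs : 0 ≤ y / (y + w) := by positivity
  have ht : 0 ≤ w / (y + w) := by positivity
  have hst : y / (y + w) + w / (y + w) = 1 := by rw [← add_div, div_self (by positivity)]
  have htriv : potential Δ m 0 l N q p f = 1 → y / (y + w) * potential Δ m (-1) (l + 1) N q p f +
      w / (y + w) * potential Δ m 1 l N (q + 1) p f ≤ potential Δ m 0 l N q p f := fun h =>
    h ▸ avg_le_one hs ht hst potential_le_one potential_le_one
  by_cases hf : f = 1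
  swap
  · exact htriv (potential_of_ne hf)
  subst hf
  by_cases hN : N < m
  · by_cases hp : p = 1
    swap
    · exact htriv (potential_warm_eq_one hN (Or.inl hp))
    subst hp
    have hκ : (0 : ℝ) < 1 / 4 * (4 ^ N / 4 ^ m) := by positivity
    rcases lt_trichotomy l N with h | h | h
    · exact htriv (potential_warm_eq_one hN (by omega))
    · subst h
      rw [potential_warm_eq hN le_rfl, potential_warm_lt hN (by norm_num) (Nat.lt_succ_self _)]
      have hup : potential Δ m 1 l l (q + 1) 1 1 ≤ 1 := potential_le_one
      -- At l = N the left neighbour is at least as heavy, so the step that doubles the gap has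
      -- probability at least 1/2.
      have hwy : w ≤ y := by
        have : (q : ℝ) = 1 + l := by exact_mod_cast hpq rfl
        rw [hy, hw, this]
        linarith
      have hhalf : w / (y + w) ≤ y / (y + w) := div_le_div_of_nonneg_right hwy (by positivity)
      nlinarith
    · rw [potential_warm_lt hN (by norm_num) h, potential_warm_lt hN (by norm_num) (by omega),
        potential_warm_lt hN (by norm_num) h, ← add_mul, hst, one_mul]
  · rw [not_lt] at hN
    rw [potential_late (pos := 0) hN, if_neg (by norm_num), add_zero]
    refine le_min (avg_le_one hs ht hst potential_le_one potential_le_one) ?_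
    rw [potential_late hN, potential_late hN, if_neg (by norm_num), if_neg (by norm_num), add_zero,
      add_zero]
    refine le_trans (add_le_add (mul_le_mul_of_nonneg_left (min_le_right _ _) hs)
      (mul_le_mul_of_nonneg_left (min_le_right _ _) ht)) ?_
    have := drift_zero (r := 4 * (2 + Δ) * ((p : ℝ) + Δ) / N) hx
      (show 0 < (l : ℝ) + 1 + Δ by linarith) (show (l : ℝ) + 1 + Δ + 1 ≤ y by linarith)
    push_cast
    rw [show (q : ℝ) + 1 + Δ = w + 1 by ring, show (l : ℝ) + 1 + 1 + Δ = (l : ℝ) + 1 + Δ + 1 by ring]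
    exact this

lemma potential_step_one (hΔ : -1 < Δ) (hm : 1 ≤ m) (hm' : 8 * (2 + Δ) * (1 + Δ) ≤ m) {z : ℕ}
    (hz : 2 + l + N ≤ z) (hq : 2 + N ≤ q) (hp : 1 ≤ p) (hpq : p = 1 → q = 2 + N) :
    ((z : ℝ) + Δ) / (((z : ℝ) + Δ) + ((p : ℝ) + Δ)) * potential Δ m 0 l (N + 1) q p f +
      ((p : ℝ) + Δ) / (((z : ℝ) + Δ) + ((p : ℝ) + Δ)) * potential Δ m 2 l N q (p + 1) f ≤
      potential Δ m 1 l N q p f := by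
  have hu := cast_add_pos hΔ hp
  have hl0 : (0 : ℝ) ≤ l := Nat.cast_nonneg l
  have hN0 : (0 : ℝ) ≤ N := Nat.cast_nonneg N
  have hz' : 2 + (l : ℝ) + N ≤ z := by exact_mod_cast hz
  have hq' : 2 + (N : ℝ) ≤ q := by exact_mod_cast hq
  set y := (z : ℝ) + Δ with hy
  set w := (p : ℝ) + Δ with hw
  have hypos : 0 < y := by linarith
  have hs : 0 ≤ y / (y + w) := by positivity
  have ht : 0 ≤ w / (y + w) := by positivity
  have hst : y / (y + w) + w / (y + w) = 1 := by rw [← add_div, div_self (by positivity)]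
  have htriv : potential Δ m 1 l N q p f = 1 → y / (y + w) * potential Δ m 0 l (N + 1) q p f +
      w / (y + w) * potential Δ m 2 l N q (p + 1) f ≤ potential Δ m 1 l N q p f := fun h =>
    h ▸ avg_le_one hs ht hst potential_le_one potential_le_one
  by_cases hf : f = 1
  swap
  · exact htriv (potential_of_ne hf)
  subst hf
  by_cases hN : N < m
  · by_cases hp1 : p = 1
    swap
    · exact htriv (potential_warm_eq_one hN (Or.inl hp1))
    subst hp1
    rcases le_or_gt l N with h | h
    · exact htriv (potential_warm_eq_one hN (by omega))
    · rw [potential_warm_lt hN le_rfl h]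
      have hup : potential Δ m 2 l N q (1 + 1) 1 ≤ 1 := potential_le_one
      have hκ : (0 : ℝ) < 1 / 4 * (4 ^ N / 4 ^ m) := by positivity
      have hdown : potential Δ m 0 l (N + 1) q 1 1 ≤ 1 - 4 * (1 / 4 * (4 ^ N / 4 ^ m)) := by
        have e : 1 - 4 * (1 / 4 * ((4 : ℝ) ^ N / 4 ^ m)) = 1 - 1 / 4 * (4 ^ (N + 1) / 4 ^ m) := by
          rw [pow_succ]; ring
        rw [e]
        by_cases hN' : N + 1 < m
        · rcases Nat.eq_or_lt_of_le (show N + 1 ≤ l from h) with h' | h'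
          · rw [← h', potential_warm_eq hN' le_rfl]
          · rw [potential_warm_lt hN' (by norm_num) h']
            have : (0 : ℝ) < 1 / 4 * (4 ^ (N + 1) / 4 ^ m) := by positivity
            linarith
        -- The warm-up ends here. The first late term is at most 1/4, the second at most 1/2 by the
        -- choice of m, and the sum 3/4 matches the final gap 1/4.
        · obtain rfl : N + 1 = m := by omega
          rw [potential_late le_rfl, div_self (by positivity), if_neg (by norm_num)]
          refine (min_le_right _ _).trans ?_
          have hqe : (q : ℝ) = 2 + N := by exact_mod_cast hpq rfl
          have hlN : (N : ℝ) + 1 ≤ l := by exact_mod_cast h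
          have h1 : ((q : ℝ) + Δ) / (4 * ((l : ℝ) + 1 + Δ)) ≤ 1 / 4 := by
            rw [div_le_div_iff₀ (by linarith) (by norm_num), hqe]
            linarith
          have h2 : 4 * (2 + Δ) * (((1 : ℕ) : ℝ) + Δ) / ((N + 1 : ℕ) : ℝ) ≤ 1 / 2 := by
            rw [div_le_div_iff₀ (by positivity) (by norm_num)]
            rw [Nat.cast_one]
            linarith
          linarith
      have hwy : w ≤ y := by
        rw [hy, hw, Nat.cast_one]
        linarith
      have hhalf : w / (y + w) ≤ y / (y + w) := div_le_div_of_nonneg_right hwy (by positivity)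
      nlinarith
  · rw [not_lt] at hN
    have hN1 : (1 : ℝ) ≤ N := by exact_mod_cast hm.trans hN
    -- Otherwise the truncated potential is already 1 and nothing is to be shown; the drift estimate
    -- needs this bound.
    by_cases hbig : ((q : ℝ) + Δ) / (4 * ((l : ℝ) + 1 + Δ)) < 1
    swap
    · refine htriv ?_
      rw [potential_late hN, if_neg (by norm_num)]
      refine min_eq_left ?_
      have : 0 ≤ 4 * (2 + Δ) * ((p : ℝ) + Δ) / N :=
        div_nonneg (mul_nonneg (by linarith) hu.le) hN0
      linarith
    rw [potential_late (pos := 1) hN, if_neg (by norm_num), add_zero]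
    refine le_min (avg_le_one hs ht hst potential_le_one potential_le_one) ?_
    rw [potential_late (hN.trans (Nat.le_succ N)), potential_late hN, if_neg (by norm_num),
      if_pos rfl, add_zero]
    refine le_trans (add_le_add (mul_le_mul_of_nonneg_left (min_le_right _ _) hs)
      (mul_le_mul_of_nonneg_left (min_le_right _ _) ht)) ?_
    have := drift_one hΔ (show 0 < (l : ℝ) + 1 + Δ by linarith) (show (0 : ℝ) < N by linarith)
      (show (l : ℝ) + 1 + Δ + N + 1 ≤ y by linarith) hu (show (N : ℝ) + 1 ≤ (q : ℝ) + Δ by linarith)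
      hbig
    push_cast
    rw [show (p : ℝ) + 1 + Δ = w + 1 by ring]
    exact this

lemma potential_step_two (hΔ : -1 < Δ) (hq : 1 ≤ q) (hp : 2 ≤ p) (hf : 1 ≤ f) :
    ((q : ℝ) + Δ) / (((q : ℝ) + Δ) + ((f : ℝ) + Δ)) * potential Δ m 1 l N (q + 1) p f +
      ((f : ℝ) + Δ) / (((q : ℝ) + Δ) + ((f : ℝ) + Δ)) * potential Δ m 3 l N q p (f + 1) ≤
      potential Δ m 2 l N q p f := by
  have hx := cast_add_pos hΔ hq
  have hu := cast_add_pos hΔ (show 1 ≤ p by omega)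
  have hf0 := cast_add_pos hΔ hf
  have hl0 : (0 : ℝ) ≤ l := Nat.cast_nonneg l
  have hN0 : (0 : ℝ) ≤ N := Nat.cast_nonneg N
  set x := (q : ℝ) + Δ with hxdef
  set w := (f : ℝ) + Δ with hw
  have hs : 0 ≤ x / (x + w) := by positivity
  have ht : 0 ≤ w / (x + w) := by positivity
  have hst : x / (x + w) + w / (x + w) = 1 := by rw [← add_div, div_self (by positivity)]
  have htriv : potential Δ m 2 l N q p f = 1 → x / (x + w) * potential Δ m 1 l N (q + 1) p f +
      w / (x + w) * potential Δ m 3 l N q p (f + 1) ≤ potential Δ m 2 l N q p f := fun h =>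
    h ▸ avg_le_one hs ht hst potential_le_one potential_le_one
  by_cases hf1 : f = 1
  swap
  · exact htriv (potential_of_ne hf1)
  subst hf1
  by_cases hN : N < m
  · exact htriv (potential_warm_eq_one hN (Or.inl (by omega)))
  · rw [not_lt] at hN
    have hB : 0 ≤ 4 * (2 + Δ) * ((p : ℝ) + Δ) / N :=
      div_nonneg (mul_nonneg (by linarith) hu.le) hN0
    by_cases hbig : x / (4 * ((l : ℝ) + 1 + Δ)) < 1
    swap
    · refine htriv ?_
      rw [potential_late hN, if_pos rfl]
      refine min_eq_left ?_
      have : 0 ≤ (2 + Δ) / x := div_nonneg (by linarith) hx.le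
      linarith
    rw [potential_late (pos := 2) hN, if_pos rfl]
    refine le_min (avg_le_one hs ht hst potential_le_one potential_le_one) ?_
    rw [potential_late hN, if_neg (by norm_num), add_zero]
    refine le_trans (add_le_add (mul_le_mul_of_nonneg_left (min_le_right _ _) hs)
      (mul_le_mul_of_nonneg_left potential_le_one ht)) ?_
    have := drift_two hΔ hx (show 0 < (l : ℝ) + 1 + Δ by linarith) hB hbig
    rw [hw]
    push_cast
    rw [show (q : ℝ) + 1 + Δ = x + 1 by ring]
    exact this

end Potential

/-! ### The potential along a path -/

section Path

variable {Δ : ℝ} {x : ℕ → ℤ}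

lemma steps_congr {x y : ℕ → ℤ} {n : ℕ} (h : ∀ k ≤ n, x k = y k) (u v : ℤ) :
    steps x n u v = steps y n u v := by
  refine Finset.sum_congr rfl fun k hk => ?_
  have hk' := Finset.mem_range.1 hk
  rw [h k hk'.le, h (k + 1) hk']

lemma cnt_extend (x : ℕ → ℤ) (n : ℕ) (j v : ℤ) :
    cnt (extend x n j) (n + 1) v = cnt x n v + if j = v then 1 else 0 := by
  rw [cnt_succ, extend_succ, cnt_congr fun k hk => extend_of_le x j hk]

lemma steps_extend (x : ℕ → ℤ) (n : ℕ) (j u v : ℤ) :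
    steps (extend x n j) (n + 1) u v = steps x n u v + if x n = u ∧ j = v then 1 else 0 := by
  rw [steps_succ, extend_succ, extend_of_le x j le_rfl,
    steps_congr fun k hk => extend_of_le x j hk]

lemma cnt_zero_of_ne {v : ℤ} (h : x 0 ≠ v) : cnt x 0 v = 1 := by simp [cnt, h]

/-- A path started left of v makes a first visit to v-1 before any step from v to v-1; this extra
visit is the second unit once the path is at or beyond v-1. -/
lemma cnt_left_ge (hx : IsNNPath x) {v : ℤ} (h0 : x 0 < v) (n : ℕ) :
    1 + steps x n v (v - 1) + (if v - 1 ≤ x n then 1 else 0) ≤ cnt x n (v - 1) := by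
  induction n with
  | zero =>
    have hs : steps x 0 v (v - 1) = 0 := rfl
    rw [hs]
    by_cases h : x 0 = v - 1
    · rw [if_pos h.ge, cnt, Finset.sum_range_one, if_pos h]
    · rw [if_neg (by omega)]
      exact one_le_cnt x 0 _
  | succ n ih =>
    rw [cnt_succ, steps_succ]
    rcases hx n with h | h <;> split_ifs at ih ⊢ <;> omega

/-- Crossings of the edge between v and v+1 alternate in direction, the first one being upward. -/
lemma steps_up_eq (hx : IsNNPath x) {v : ℤ} (h0 : x 0 ≤ v) (n : ℕ) :
    steps x n v (v + 1) = steps x n (v + 1) v + if v + 1 ≤ x n then 1 else 0 := by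
  induction n with
  | zero => rw [if_neg (by omega)]; rfl
  | succ n ih =>
    rw [steps_succ, steps_succ]
    rcases hx n with h | h <;> split_ifs at ih ⊢ <;> omega

/-- The value of `potential` along a path. -/
noncomputable def pathPotential (Δ : ℝ) (m : ℕ) (v : ℤ) (n : ℕ) (x : ℕ → ℤ) : ℝ :=
  potential Δ m (x n - v) (steps x n v (v - 1)) (steps x n (v + 1) v) (cnt x n (v + 1))
    (cnt x n (v + 2)) (cnt x n (v + 3))

lemma pathPotential_congr (Δ : ℝ) (m : ℕ) (v : ℤ) (n : ℕ) {x y : ℕ → ℤ}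
    (h : ∀ k ≤ n, x k = y k) : pathPotential Δ m v n x = pathPotential Δ m v n y := by
  unfold pathPotential
  simp only [steps_congr h, cnt_congr h, h n le_rfl]

lemma abs_pathPotential_le (hΔ : -1 < Δ) (m : ℕ) (v : ℤ) (n : ℕ) (x : ℕ → ℤ) :
    |pathPotential Δ m v n x| ≤ 1 := by
  unfold pathPotential
  rw [abs_of_nonneg (potential_nonneg hΔ (one_le_cnt _ _ _) (one_le_cnt _ _ _))]
  exact potential_le_one

lemma potential_congr_pos {m : ℕ} {pos pos' : ℤ} {l N q p f : ℕ} (h : pos ≤ 0) (h' : pos' ≤ 0) :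
    potential Δ m pos l N q p f = potential Δ m pos' l N q p f := by
  unfold potential
  simp only [h, h', show pos ≤ 1 by omega, show pos' ≤ 1 by omega, show pos ≠ 2 by omega,
    show pos' ≠ 2 by omega]

lemma pathPotential_step (hΔ : -1 < Δ) {m : ℕ} (hm : 1 ≤ m) (hm' : 8 * (2 + Δ) * (1 + Δ) ≤ m)
    (hx : IsNNPath x) {v : ℤ} (h0 : x 0 < v) (n : ℕ) :
    probDown Δ x n * pathPotential Δ m v (n + 1) (extend x n (x n - 1)) +
      probUp Δ x n * pathPotential Δ m v (n + 1) (extend x n (x n + 1)) ≤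
      pathPotential Δ m v n x := by
  have hle1 : ∀ y k, pathPotential Δ m v k y ≤ 1 := fun y k => potential_le_one
  have i1 := cnt_left_ge hx h0 n
  have i2 := steps_up_eq hx h0.le n
  have i3 := steps_up_eq hx (v := v + 1) (by omega) n
  have i4 := steps_up_eq hx (v := v + 2) (by omega) n
  have c0 := cnt_eq_steps_out hx n v
  have c1 := cnt_eq_steps_in hx n (v + 1)
  have c2 := cnt_eq_steps_in hx n (v + 2)
  have c2' := cnt_eq_steps_out hx n (v + 2)
  have c3 := cnt_eq_steps_in hx n (v + 3)
  rw [cnt_zero_of_ne (by omega), show v + 1 - 1 = v by ring, show v + 1 + 1 = v + 2 by ring] at c1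
  rw [cnt_zero_of_ne (by omega), show v + 2 - 1 = v + 1 by ring] at c2
  rw [cnt_zero_of_ne (by omega), show v + 3 - 1 = v + 2 by ring] at c3
  rw [show v + 1 + 1 = v + 2 by ring] at i3
  rw [show v + 2 + 1 = v + 3 by ring] at i4
  rcases lt_or_ge (x n) v with h | h
  · have hst := probDown_add_probUp hΔ x n
    have e : ∀ j, j ≤ v → pathPotential Δ m v (n + 1) (extend x n j) = pathPotential Δ m v n x := by
      intro j hj
      unfold pathPotential
      simp only [cnt_extend, steps_extend, extend_succ]
      rw [if_neg (by omega), if_neg (by omega), if_neg (by omega), if_neg (by omega),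
        if_neg (by omega)]
      exact potential_congr_pos (by omega) (by omega)
    rw [e _ (by omega), e _ (by omega), ← add_mul, hst, one_mul]
  rcases (by omega : x n = v ∨ x n = v + 1 ∨ x n = v + 2 ∨ v + 3 ≤ x n) with h | h | h | h
  · rw [if_pos (by omega)] at i1
    rw [if_neg (by omega)] at i2 i3
    have key := potential_step_zero (m := m) (p := cnt x n (v + 2)) (f := cnt x n (v + 3)) hΔ
      (show steps x n v (v - 1) + 2 ≤ cnt x n (v - 1) by omega) (one_le_cnt x n (v + 1))
      (N := steps x n (v + 1) v) (fun hp => by omega)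
    unfold pathPotential probDown probUp
    simp only [cnt_extend, steps_extend, extend_succ, h]
    simpa [show v - 1 - v = -1 by ring, show v + 1 - v = 1 by ring, show v - 1 ≠ v + 1 by omega,
      show v - 1 ≠ v + 2 by omega, show v - 1 ≠ v + 3 by omega, show v + 1 ≠ v - 1 by omega]
      using key
  · rw [if_pos (by omega)] at i2
    rw [if_neg (by omega)] at i3 c0
    have key := potential_step_one (m := m) (f := cnt x n (v + 3)) hΔ hm hm'
      (show 2 + steps x n v (v - 1) + steps x n (v + 1) v ≤ cnt x n v by omega)
      (show 2 + steps x n (v + 1) v ≤ cnt x n (v + 1) by omega) (one_le_cnt x n (v + 2))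
      (fun hp => by omega)
    unfold pathPotential probDown probUp
    simp only [cnt_extend, steps_extend, extend_succ, h]
    simpa [show v + 1 - 1 = v by ring, show v + 1 + 1 = v + 2 by ring] using key
  · rw [if_pos h] at c2'
    have key := potential_step_two (m := m) (l := steps x n v (v - 1)) (N := steps x n (v + 1) v)
      hΔ (one_le_cnt x n (v + 1)) (show 2 ≤ cnt x n (v + 2) by omega) (one_le_cnt x n (v + 3))
    unfold pathPotential probDown probUp
    simp only [cnt_extend, steps_extend, extend_succ, h]
    simpa [show v + 2 - 1 = v + 1 by ring, show v + 2 + 1 = v + 3 by ring] using key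
  · rw [if_pos (by omega)] at i4
    have : pathPotential Δ m v n x = 1 := potential_of_ne (by omega)
    rw [this]
    exact avg_le_one (probDown_nonneg hΔ x n) (probUp_nonneg hΔ x n) (probDown_add_probUp hΔ x n)
      (hle1 _ _) (hle1 _ _)

lemma le_start_add (hx : IsNNPath x) (n : ℕ) : x n ≤ x 0 + n := by
  induction n with
  | zero => simp
  | succ n ih => push_cast; rcases hx n with h | h <;> omega

lemma pathPotential_fresh {m : ℕ} (hm : 1 ≤ m) {v : ℤ} {n : ℕ} (h : ∀ k ≤ n, x k < v) :
    pathPotential Δ m v n x = 1 - 1 / 4 * (4 ^ 0 / 4 ^ m) := by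
  have hc : ∀ w, v ≤ w → cnt x n w = 1 := fun w hw => by
    unfold cnt
    rw [Finset.sum_eq_zero fun k hk => if_neg ?_]
    have := h k (Nat.lt_succ_iff.1 (Finset.mem_range.1 hk))
    omega
  have hs : ∀ u w, v ≤ u → steps x n u w = 0 := fun u w hu =>
    Finset.sum_eq_zero fun k hk => if_neg fun h' => by
      have := h k (Finset.mem_range.1 hk).le
      omega
  unfold pathPotential
  rw [hc _ (by omega), hc _ (by omega), hc _ (by omega), hs _ _ le_rfl, hs _ _ (by omega)]
  exact potential_warm_eq (by omega) (by have := h n le_rfl; omega)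

end Path

/-! ### Boundedness of the walk -/

section Walk

variable {Ω : Type*} [mΩ : MeasurableSpace Ω] {μ : Measure Ω} [IsProbabilityMeasure μ] {Δ : ℝ}
  {v₀ : ℤ} {X : ℕ → Ω → ℤ}

lemma ae_isNNPath (hX : IsVRRW μ Δ v₀ X) : ∀ᵐ ω ∂μ, IsNNPath (traj X ω) := ae_step_mem hX

lemma supermartingale_pathPotential (hΔ : -1 < Δ) (hX : IsVRRW μ Δ v₀ X) {m : ℕ} (hm : 1 ≤ m)
    (hm' : 8 * (2 + Δ) * (1 + Δ) ≤ m) {v : ℤ} (hv : v₀ < v) :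
    Supermartingale (fun n ω => pathPotential Δ m v n (traj X ω)) (pastFiltration hX.measurable)
      μ := by
  refine supermartingale_nat
    (fun n => (measurable_past (F := pathPotential Δ m v n)
      fun x y h => pathPotential_congr Δ m v n h).stronglyMeasurable)
    (fun n => integrable_traj_functional hX.measurable
      (fun x y h => pathPotential_congr Δ m v n h) (abs_pathPotential_le hΔ m v n)) fun n => ?_
  refine (condExp_traj hX (fun x y h => pathPotential_congr Δ m v (n + 1) h)
    (abs_pathPotential_le hΔ m v (n + 1))).trans_le ?_
  filter_upwards [ae_isNNPath hX, hX.start] with ω hω h0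
  exact pathPotential_step hΔ hm hm' hω (h0.trans_lt hv) n

/-- Almost surely the walk is bounded above. -/
theorem ae_bddAbove (hΔ : -1 < Δ) (hX : IsVRRW μ Δ v₀ X) :
    ∀ᵐ ω ∂μ, ∃ K : ℤ, ∀ n, X n ω < K := by
  obtain ⟨m, hm'⟩ := exists_nat_ge (max 1 (8 * (2 + Δ) * (1 + Δ)))
  have hm : 1 ≤ m := by exact_mod_cast (le_max_left _ _).trans hm'
  replace hm' := (le_max_right _ _).trans hm'
  set κ : ℝ := 1 / 4 * (4 ^ 0 / 4 ^ m) with hκdef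
  have hκ : 0 < κ := by positivity
  set 𝓕 := pastFiltration hX.measurable
  let A : Set Ω := {ω | ∀ K : ℤ, ∃ n, K ≤ X n ω}
  have hA : MeasurableSet[⨆ n, 𝓕 n] A := by
    have : A = ⋂ K : ℤ, ⋃ n, X n ⁻¹' Set.Ici K := by
      ext ω; simp [A]
    rw [this]
    refine MeasurableSet.iInter fun K => MeasurableSet.iUnion fun n => ?_
    exact le_iSup (fun n => 𝓕 n) n _
      (measurable_coord_past (X := X) le_rfl (MeasurableSet.of_discrete (s := Set.Ici K)))
  have hA' : MeasurableSet A := (iSup_le fun n => 𝓕.le n : ⨆ n, 𝓕 n ≤ mΩ) _ hA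
  let g : Ω → ℝ := A.indicator fun _ => 1
  have hg : Integrable g μ := (integrable_const 1).indicator hA'
  have hbound : ∀ n, ∀ s, MeasurableSet[𝓕 n] s → ∫ ω in s, g ω ∂μ ≤ ∫ _ in s, (1 - κ) ∂μ := by
    intro n s hs
    -- No path can reach this site by time n, so at time n the potential has its fresh value 1 - κ.
    set v : ℤ := v₀ + n + 1 with hv
    have hsup := supermartingale_pathPotential hΔ hX hm hm' (v := v) (by omega)
    let f : ℕ → Ω → ℝ := fun k ω => pathPotential Δ m v k (traj X ω)
    have hfint : ∀ k, Integrable (f k) μ := hsup.integrable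
    have hf1 : ∀ k ω, |f k ω| ≤ 1 := fun k ω => abs_pathPotential_le hΔ m v k _
    have hf0 : ∀ k ω, 0 ≤ f k ω := fun k ω =>
      potential_nonneg hΔ (one_le_cnt _ _ _) (one_le_cnt _ _ _)
    have hs' : MeasurableSet s := 𝓕.le n _ hs
    -- An unbounded path visits v + 3, and the potential equals 1 from then on.
    have hlim : Tendsto (fun k => ∫ ω in s, A.indicator (f k) ω ∂μ) atTop (𝓝 (∫ ω in s, g ω ∂μ)) := by
      refine tendsto_integral_of_dominated_convergence (fun _ => (1 : ℝ))
        (fun k => ((hfint k).indicator hA').aestronglyMeasurable.restrict) (integrable_const 1)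
        (fun k => ae_of_all _ fun ω => ?_) (ae_restrict_of_ae ?_)
      · rw [Real.norm_eq_abs]
        by_cases h : ω ∈ A
        · rw [Set.indicator_of_mem h]; exact hf1 k ω
        · rw [Set.indicator_of_notMem h]; simp
      · filter_upwards [ae_isNNPath hX, hX.start] with ω hω h0
        by_cases h : ω ∈ A
        · simp only [g, Set.indicator_of_mem h]
          obtain ⟨j, hj⟩ := h (v + 3)
          obtain ⟨i, -, -, hi⟩ := exists_eq_between hω (Nat.zero_le j)
            (show traj X ω 0 ≤ v + 3 by have : traj X ω 0 = v₀ := h0; omega) hj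
          refine tendsto_const_nhds.congr' ?_
          filter_upwards [eventually_ge_atTop i] with k hk
          refine (potential_of_ne ?_).symm
          have h1 : cnt (traj X ω) i (v + 3) ≤ cnt (traj X ω) k (v + 3) := cnt_mono _ _ hk
          have h2 := cnt_eq_steps_out hω i (v + 3)
          rw [if_pos hi] at h2
          omega
        · simp only [g, Set.indicator_of_notMem h]
          exact tendsto_const_nhds
    refine le_of_tendsto hlim ?_
    filter_upwards [eventually_ge_atTop n] with k hk
    calc ∫ ω in s, A.indicator (f k) ω ∂μ ≤ ∫ ω in s, f k ω ∂μ :=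
          setIntegral_mono ((hfint k).indicator hA').integrableOn (hfint k).integrableOn
            fun ω => Set.indicator_le_self' (fun _ _ => hf0 k ω) ω
      _ ≤ ∫ ω in s, f n ω ∂μ := hsup.setIntegral_le hk hs
      _ = ∫ _ in s, (1 - κ) ∂μ := by
          refine setIntegral_congr_ae hs' ?_
          filter_upwards [ae_isNNPath hX, hX.start] with ω hω h0 _
          refine pathPotential_fresh hm fun i hi => ?_
          have h1 := le_start_add hω i
          have h2 : traj X ω 0 = v₀ := h0
          omega
  have hcond : ∀ n, ∀ᵐ ω ∂μ, (μ[g | 𝓕 n]) ω ≤ 1 - κ := by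
    intro n
    have hle := 𝓕.le n
    refine ae_le_of_ae_le_trim (hm := hle) (f₂ := fun _ => 1 - κ) ?_
    refine ae_le_of_forall_setIntegral_le
      (integrable_condExp.trim hle stronglyMeasurable_condExp) (integrable_const _) fun s hs _ => ?_
    rw [← setIntegral_trim hle stronglyMeasurable_condExp hs,
      ← setIntegral_trim hle stronglyMeasurable_const hs, setIntegral_condExp hle hg hs]
    exact hbound n s hs
  -- The conditional probabilities of A converge to its indicator but stay at most 1 - κ, so the
  -- indicator is never 1.
  have hlevy := hg.tendsto_ae_condExp (ℱ := 𝓕) (stronglyMeasurable_const.indicator hA)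
  filter_upwards [ae_all_iff.2 hcond, hlevy] with ω h1 h2
  have h3 : g ω ≤ 1 - κ := le_of_tendsto' h2 h1
  by_contra hcon
  push Not at hcon
  have : ω ∈ A := hcon
  simp only [g, Set.indicator_of_mem this] at h3
  linarith

end Walk

/-! ### Reflection and existence of a recurrent site -/

lemma Z_neg {Ω : Type*} (X : ℕ → Ω → ℤ) (n : ℕ) (v : ℤ) (ω : Ω) :
    Z (fun n ω => -X n ω) n v ω = Z X n (-v) ω := by
  simp only [Z, neg_eq_iff_eq_neg]

lemma IsVRRW.neg {Ω : Type*} [MeasurableSpace Ω] {μ : Measure Ω} {Δ : ℝ} {v₀ : ℤ}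
    {X : ℕ → Ω → ℤ} (hX : IsVRRW μ Δ v₀ X) : IsVRRW μ Δ (-v₀) fun n ω => -X n ω where
  measurable n := (hX.measurable n).neg
  start := by filter_upwards [hX.start] with ω h using by rw [h]
  step n j := by
    have hpast : past (fun n ω => -X n ω) n = past X n := by
      unfold past
      refine iSup_congr fun k => iSup_congr fun _ => ?_
      ext s
      constructor
      · rintro ⟨t, -, rfl⟩
        exact ⟨Neg.neg ⁻¹' t, trivial, rfl⟩
      · rintro ⟨t, -, rfl⟩
        exact ⟨Neg.neg ⁻¹' t, trivial, by ext ω; simp⟩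
    have hset : {ω | -X (n + 1) ω = j} = {ω | X (n + 1) ω = -j} := by
      ext ω
      exact neg_eq_iff_eq_neg
    rw [hpast, hset]
    filter_upwards [hX.step n (-j)] with ω h
    rw [h]
    unfold stepProb
    simp only [Z_neg]
    rw [show |-X n ω - j| = |X n ω - -j| by rw [← abs_neg]; congr 1; ring,
      show -(-X n ω - 1) = X n ω + 1 by ring, show -(-X n ω + 1) = X n ω - 1 by ring,
      add_comm (W Δ (Z X n (X n ω + 1) ω))]

lemma recurrentSites_nonempty {x : ℕ → ℤ} {a b : ℤ} (ha : ∀ n, a < x n) (hb : ∀ n, x n < b) :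
    (recurrentSites x).Nonempty := by
  by_contra h
  have hfin : ∀ v, {k | x k = v}.Finite := fun v => by
    by_contra hv
    exact h ⟨v, hv⟩
  have hU : (⋃ v ∈ Set.Icc a b, {k | x k = v}).Finite := (Set.finite_Icc a b).biUnion fun v _ => hfin v
  refine Set.infinite_univ (hU.subset fun k _ => ?_)
  simp only [Set.mem_iUnion]
  exact ⟨x k, ⟨(ha k).le, (hb k).le⟩, rfl⟩

end VRRW

theorem mainTheorem5 {Ω : Type*} [MeasurableSpace Ω] (μ : Measure Ω) [IsProbabilityMeasure μ]
    (Δ : ℝ) (hΔ : -1 < Δ) (v₀ : ℤ) (X : ℕ → Ω → ℤ) (hX : VRRW.IsVRRW μ Δ v₀ X) :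
    (∀ x : ℤ, ∀ᵐ ω ∂μ,
      VRRW.asympRange X ω = {x - 2, x - 1, x, x + 1, x + 2} →
        ∃ αm αp : ℝ, αm ∈ Set.Ioo (0 : ℝ) 1 ∧
          Tendsto (fun n => VRRW.alphaMinus X n x ω) atTop (𝓝 αm) ∧
          Tendsto (fun n => VRRW.alphaPlus X n x ω) atTop (𝓝 αp) ∧
          Tendsto (fun n => Real.log (VRRW.Z X n (x - 2) ω) / Real.log (VRRW.Z X n x ω))
            atTop (𝓝 αm) ∧
          Tendsto (fun n => Real.log (VRRW.Z X n (x + 2) ω) / Real.log (VRRW.Z X n x ω))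
            atTop (𝓝 αp)) ∧
    (∀ᵐ ω ∂μ, 5 ≤ (VRRW.asympRange X ω).encard) := by
  have hconv := ae_all_iff.2 fun v => VRRW.ae_exists_tendsto_flowDiff hΔ hX v
  refine ⟨fun x => ?_, ?_⟩
  · filter_upwards [hconv, VRRW.ae_isNNPath hX] with ω hM hpath hR
    rw [VRRW.asympRange_eq] at hR
    exact VRRW.tendsto_log_ratio_of_five hΔ hpath hM hR
  · filter_upwards [hconv, VRRW.ae_isNNPath hX, VRRW.ae_bddAbove hΔ hX,
      VRRW.ae_bddAbove hΔ hX.neg] with ω hM hpath ⟨b, hb⟩ ⟨a, ha⟩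
    rw [VRRW.asympRange_eq]
    exact VRRW.five_le_encard_recurrentSites hΔ hpath hM
      (VRRW.recurrentSites_nonempty (a := -a) (fun n => neg_lt.1 (ha n)) hb)
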